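/- Let $n\ge 1$, let $B_r$ denote the open ball of radius $r$ centred at the origin of $\mathbb R^n$, and let $\mathcal S^{n\times n}$ be the space of real symmetric $n\times n$ matrices. Let $\epsilon>0$ and let $F=F(r,s,p,M)\in C^1\big((0,1+\epsilon)\times\mathbb R\times\mathbb R^n\times\mathcal S^{n\times n}\big)$ be elliptic, i.e. the symmetric matrix $$\Big(-\frac{\partial F}{\partial M_{ij}}(r,s,p,M)\Big)$$ is positive definite for all $0<r<1+\epsilon$, $s\in\mathbb R$, $p\in\mathbb R^n$, $M\in\mathcal S^{n\times n}$. Here $(\partial F/\partial M_{ij})$ is the symmetric matrix that represents the differential of $F$ in $M$: the derivative of $F$ in the direction $N\in\mathcal S^{n\times n}$ is $\sum_{i,j}\frac{\partial F}{\partial M_{ij}}N_{ij}$. Assume further that, for all $0<r<1+\epsilon$, $s>0$, $p\in\mathbb R^n$, $M\in\mathcal S^{n\times n}$ and all orthogonal matrices $O\in O(n)$, $$\frac{\partial F}{\partial r}(r,s,p,M)\ge 0\qquad\text{and}\qquad F(r,s,O^tp,O^tMO)=F(r,s,p,M).$$ Let $u\in C^2(\overline B_1\setminus\{0\})$ be such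 that, for some $\bar r>0$: for every $V\in\mathbb R^n$ the function $w(x)=u(x)+V\cdot x$ satisfies $$\inf_{B_r\setminus\{0\}}w=\min_{\partial B_r}w\qquad\text{for all }0<r<\bar r .$$ Suppose that $$F(|x|,u,\nabla u,\nabla^2u)=0,\quad u>0\quad\text{in }B_1\setminus\{0\},\qquad u=0\quad\text{on }\partial B_1 .$$ Then $u$ is radially symmetric about the origin, $u(x)=u(|x|)$ for $x\in\overline B_1\setminus\{0\}$, and $u'(r)<0$ for $0<r<1$. -/

import Mathlib

attribute [local instance] Matrix.normedAddCommGroup Matrix.normedSpace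

namespace PuncturedBall

noncomputable section

/-- The Euclidean space `ℝⁿ`. -/
abbrev E (n : ℕ) : Type := EuclideanSpace ℝ (Fin n)

/-- The vector space `𝒮^{n×n}` of real symmetric matrices (normed by the largest absolute value of
an entry; only the topology matters, as the space is finite-dimensional). -/
def SymMat (n : ℕ) : Submodule ℝ (Matrix (Fin n) (Fin n) ℝ) where
  carrier := {M | M.IsSymm}
  add_mem' := fun ha hb => ha.add hb
  zero_mem' := Matrix.isSymm_zero
  smul_mem' := fun c _ h => h.smul c

/-- The symmetric part `(A + Aᵀ) / 2` of a matrix, as an element of `SymMat n`. -/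
def symPart {n : ℕ} (A : Matrix (Fin n) (Fin n) ℝ) : SymMat n :=
  ⟨(1 / 2 : ℝ) • (A + A.transpose), (Matrix.isSymm_add_transpose_self A).smul _⟩

theorem coe_symPart_of_isSymm {n : ℕ} {A : Matrix (Fin n) (Fin n) ℝ} (h : A.IsSymm) :
    (symPart A : Matrix (Fin n) (Fin n) ℝ) = A := by
  ext i j
  simp only [symPart, h.eq, Matrix.smul_apply, Matrix.add_apply, smul_eq_mul]
  ring

/-- The matrix `(∂ᵢ∂ⱼ u(x))` of second partial derivatives. -/
def hessianMatrix {n : ℕ} (u : E n → ℝ) (x : E n) : Matrix (Fin n) (Fin n) ℝ :=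
  Matrix.of fun i j =>
    fderiv ℝ (fun y => fderiv ℝ u y (EuclideanSpace.single j 1)) x (EuclideanSpace.single i 1)

/-- The Hessian `∇²u(x)` as a symmetric matrix. Taking the symmetric part changes nothing where `u`
is `C²`, see `coe_hessian`. -/
def hessian {n : ℕ} (u : E n → ℝ) (x : E n) : SymMat n :=
  symPart (hessianMatrix u x)

theorem coe_hessian {n : ℕ} {u : E n → ℝ} {x : E n} (hu : ContDiffAt ℝ 2 u x) :
    (hessian u x : Matrix (Fin n) (Fin n) ℝ) = hessianMatrix u x := by
  apply coe_symPart_of_isSymm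
  have hs : IsSymmSndFDerivAt ℝ u x := hu.isSymmSndFDerivAt (by simp)
  have hd : DifferentiableAt ℝ (fderiv ℝ u) x :=
    (hu.fderiv_right (m := 1) (by norm_num)).differentiableAt (by norm_num)
  have key : ∀ v w : E n, fderiv ℝ (fun y => fderiv ℝ u y v) x w
      = fderiv ℝ (fderiv ℝ u) x w v := by
    intro v w
    rw [fderiv_clm_apply hd (differentiableAt_const v)]
    simp
  ext i j
  simp only [hessianMatrix, Matrix.transpose_apply, Matrix.of_apply, key]
  exact hs _ _

/-- The matrix `(∂F/∂Mᵢⱼ(r, s, p, M))` for a function `F` of symmetric matrices: the symmetric matrix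
that represents the differential of `F` in `M` for the pairing `∑ᵢⱼ Aᵢⱼ Nᵢⱼ`. Its `(i, j)` entry is
the derivative in the direction `(Eᵢⱼ + Eⱼᵢ) / 2`, with `Eᵢⱼ` the matrix units. -/
def gradM {n : ℕ} (F : ℝ → ℝ → E n → SymMat n → ℝ) (r s : ℝ) (p : E n) (M : SymMat n) :
    Matrix (Fin n) (Fin n) ℝ :=
  Matrix.of fun i j => fderiv ℝ (F r s p) M (symPart (Matrix.single i j 1))

/-- `O p`, for a matrix `O` and a vector `p`. -/
def act {n : ℕ} (O : Matrix (Fin n) (Fin n) ℝ) (p : E n) : E n :=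
  WithLp.toLp 2 (O.mulVec p.ofLp)

/-- `Oᵗ M O`, for a matrix `O` and a symmetric matrix `M`. -/
def conj {n : ℕ} (O : Matrix (Fin n) (Fin n) ℝ) (M : SymMat n) : SymMat n :=
  ⟨O.transpose * (M : Matrix (Fin n) (Fin n) ℝ) * O, by
    have h : (M : Matrix (Fin n) (Fin n) ℝ).transpose = M := M.2
    change (O.transpose * (M : Matrix (Fin n) (Fin n) ℝ) * O).transpose = _
    simp [Matrix.transpose_mul, h, Matrix.mul_assoc]⟩

/-- For every `V ∈ ℝⁿ` and every `0 < r < rbar`, the function `w(x) = u(x) + V · x` satisfies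
`inf_{B_r ∖ {0}} w = min_{∂B_r} w` (in particular the infimum is finite). -/
def SuperaffineNearZero {n : ℕ} (u : E n → ℝ) (rbar : ℝ) : Prop :=
  ∀ V : E n, ∀ r : ℝ, 0 < r → r < rbar → ∃ m : ℝ,
    IsGLB ((fun x => u x + inner ℝ V x) '' (Metric.ball 0 r \ {0})) m ∧
    IsLeast ((fun x => u x + inner ℝ V x) '' Metric.sphere 0 r) m

end

end PuncturedBall

/-! The proof is by moving planes. Fix a unit vector `e`, let `refl e l` be the reflection in ⟨x, e⟩
= l, and put v = u ∘ `refl e l`. The aim is `ReflLE`: u ≤ v on the cap beyond the plane, except at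
2le, the mirror image of the origin. Points of the cap have reflections of no larger norm, so
rotation invariance and monotonicity of F in r make v a supersolution there
(`jet_comp_refl_nonneg`). The inequality holds for l near 1 by a maximum principle in narrow slabs
(`reflLE_of_narrow`), and a compactness argument (`eventually_le_refl_of_le_inner`) combined with
the same principle pushes it down to every positive l, hence to l = 0 by continuity (`reflLE`). At l
= 0, two distinct points of equal norm are exchanged by a suitable reflection, so u is radial; for 0
< l < 1 the Hopf lemma at le, applied to u and v, gives the sign of the derivative.

The comparison arguments rest on one principle, `no_touching`: if q is a quadratic polynomial convex
enough in one direction and δ is small, a supersolution v cannot touch u + δq from above. The mean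
value theorem along the segment of jets shows that F drops strictly from the jet of u to that of u +
δq, and ellipticity makes F at the jet of v smaller still. Only the jets of u must stay in a compact
set; v may have unbounded second derivatives. The Hopf lemma, the strong maximum principle and the
slab principle differ only in the choice of q.

The singularity of v at 2le is treated in `exists_add_le_of_singular`. A negative infimum of v - u -
δh over the punctured ball would persist under small linear tilts, hence v - u - δh would lie above
a cone with vertex at the singular point. The assumption on affine perturbations of u then lifts v
near the vertex too (`exists_add_le_of_cone`), so the infimum would not be approached anywhere. -/

namespace PuncturedBall
open scoped MatrixOrder
open Matrix Set Filter Topology Metric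

/-! ### Symmetric matrices, quadratic forms, traces -/

/-- The map `A ↦ (A + Aᵀ) / 2` as a linear map. -/
noncomputable def symPartₗ (n : ℕ) : Matrix (Fin n) (Fin n) ℝ →ₗ[ℝ] SymMat n where
  toFun := symPart
  map_add' A B := by
    ext i j
    simp [symPart]
    ring
  map_smul' c A := by
    ext i j
    simp [symPart]
    ring

/-- The rank one matrix `e eᵀ`. -/
def outer {n : ℕ} (e : E n) : SymMat n :=
  ⟨vecMulVec e e, by
    change (vecMulVec _ _).transpose = _
    rw [transpose_vecMulVec]⟩

/-- The identity as a symmetric matrix. -/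
def idMat (n : ℕ) : SymMat n := ⟨1, isSymm_one⟩

/-- The quadratic form of a symmetric matrix. -/
def quad {n : ℕ} (M : SymMat n) (ξ : E n) : ℝ := ξ.ofLp ⬝ᵥ (M : Matrix (Fin n) (Fin n) ℝ) *ᵥ ξ.ofLp

theorem quad_add {n : ℕ} (M N : SymMat n) (ξ : E n) : quad (M + N) ξ = quad M ξ + quad N ξ := by
  simp [quad, add_mulVec, dotProduct_add]

theorem quad_sub {n : ℕ} (M N : SymMat n) (ξ : E n) : quad (M - N) ξ = quad M ξ - quad N ξ := by
  simp [quad, sub_mulVec, dotProduct_sub]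

theorem quad_smul {n : ℕ} (c : ℝ) (M : SymMat n) (ξ : E n) : quad (c • M) ξ = c * quad M ξ := by
  simp [quad, smul_mulVec, dotProduct_smul]

theorem quad_outer {n : ℕ} (e ξ : E n) : quad (outer e) ξ = (inner ℝ ξ e) ^ 2 := by
  simp only [quad, outer, vecMulVec_mulVec, dotProduct_smul, PiLp.inner_apply, sq]
  simp [dotProduct, mul_comm]

theorem quad_idMat {n : ℕ} (ξ : E n) : quad (idMat n) ξ = ‖ξ‖ ^ 2 := by
  simp only [quad, idMat, one_mulVec, EuclideanSpace.real_norm_sq_eq]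
  simp [dotProduct, sq]

theorem posSemidef_of_quad {n : ℕ} {M : SymMat n} (h : ∀ ξ, 0 ≤ quad M ξ) :
    (M : Matrix (Fin n) (Fin n) ℝ).PosSemidef := by
  refine PosSemidef.of_dotProduct_mulVec_nonneg ?_ fun x => ?_
  · have := M.2
    change (M : Matrix (Fin n) (Fin n) ℝ).transpose = _ at this
    rw [IsHermitian, conjTranspose_eq_transpose_of_trivial, this]
  · simpa [quad] using h (WithLp.toLp 2 x)

/-- Factor N = B*B; cyclicity of the trace turns tr(AN) into tr(BAB*), the trace of a positive
semidefinite matrix. -/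
theorem trace_mul_nonneg_of_posSemidef {n : ℕ} {A N : Matrix (Fin n) (Fin n) ℝ}
    (hA : A.PosSemidef) (hN : N.PosSemidef) : 0 ≤ (A * N).trace := by
  obtain ⟨B, rfl⟩ := CStarAlgebra.nonneg_iff_eq_star_mul_self.mp hN.nonneg
  rw [star_eq_conjTranspose]
  rw [← Matrix.mul_assoc, trace_mul_comm, ← Matrix.mul_assoc]
  exact (hA.mul_mul_conjTranspose_same B).trace_nonneg

theorem trace_mul_vecMulVec {n : ℕ} (A : Matrix (Fin n) (Fin n) ℝ) (e : Fin n → ℝ) :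
    (A * vecMulVec e e).trace = e ⬝ᵥ A *ᵥ e := by
  rw [mul_vecMulVec, trace_vecMulVec, dotProduct_comm]

/-! ### Ellipticity as monotonicity in the matrix variable -/

/-- The domain of definition of the operator. -/
def dom (n : ℕ) (ε : ℝ) : Set (ℝ × ℝ × E n × SymMat n) := Ioo 0 (1 + ε) ×ˢ univ

/-- The function of one variable associated with `F`. -/
def uncurry4 {n : ℕ} (F : ℝ → ℝ → E n → SymMat n → ℝ) : ℝ × ℝ × E n × SymMat n → ℝ :=
  fun q => F q.1 q.2.1 q.2.2.1 q.2.2.2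

theorem isOpen_dom (n : ℕ) (ε : ℝ) : IsOpen (dom n ε) := isOpen_Ioo.prod isOpen_univ

/-- The embedding of `𝒮^{n×n}` as the last factor. -/
def inM (n : ℕ) : SymMat n →L[ℝ] ℝ × ℝ × E n × SymMat n :=
  (ContinuousLinearMap.inr ℝ ℝ (ℝ × E n × SymMat n)).comp
    ((ContinuousLinearMap.inr ℝ ℝ (E n × SymMat n)).comp
      (ContinuousLinearMap.inr ℝ (E n) (SymMat n)))

theorem inM_apply {n : ℕ} (N : SymMat n) : inM n N = (0, 0, 0, N) := rfl

theorem hasFDerivAt_last {n : ℕ} {F : ℝ → ℝ → E n → SymMat n → ℝ} {r s : ℝ} {p : E n}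
    {M : SymMat n} (h : DifferentiableAt ℝ (uncurry4 F) (r, s, p, M)) :
    HasFDerivAt (F r s p) ((fderiv ℝ (uncurry4 F) (r, s, p, M)).comp (inM n)) M := by
  have h2 : HasFDerivAt (fun N : SymMat n => ((r, s, p, N) : ℝ × ℝ × E n × SymMat n))
      (inM n) M := by
    refine (((inM n).hasFDerivAt (x := M)).const_add (r, s, p, (0 : SymMat n))).congr_of_eventuallyEq
      (.of_forall fun N => ?_)
    simp [inM_apply]
  exact h.hasFDerivAt.comp (f := fun N : SymMat n => ((r, s, p, N) : ℝ × ℝ × E n × SymMat n)) M h2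

/-- Symmetrization fixes N, so N is a combination of the symmetrized matrix units on which `gradM`
is defined, with its own entries as coefficients. -/
theorem fderiv_inM_eq_trace {n : ℕ} {F : ℝ → ℝ → E n → SymMat n → ℝ} {r s : ℝ} {p : E n}
    {M : SymMat n} (h : DifferentiableAt ℝ (uncurry4 F) (r, s, p, M)) (N : SymMat n) :
    fderiv ℝ (uncurry4 F) (r, s, p, M) (0, 0, 0, N) =
      (gradM F r s p M * (N : Matrix (Fin n) (Fin n) ℝ)).trace := by
  have hsym : ∀ i j, (N : Matrix (Fin n) (Fin n) ℝ) i j = (N : Matrix (Fin n) (Fin n) ℝ) j i := by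
    intro i j
    have := N.2
    change (N : Matrix (Fin n) (Fin n) ℝ).transpose = _ at this
    exact congrFun (congrFun this j) i
  have hN : N = ∑ i, ∑ j, (N : Matrix (Fin n) (Fin n) ℝ) i j • symPart (Matrix.single i j 1) := by
    have h1 : N = symPartₗ n N := by
      ext i j
      exact (congrFun (congrFun (coe_symPart_of_isSymm N.2) i) j).symm
    conv_lhs => rw [h1, matrix_eq_sum_single (N : Matrix (Fin n) (Fin n) ℝ)]
    simp only [map_sum]
    refine Finset.sum_congr rfl fun i _ => Finset.sum_congr rfl fun j _ => ?_
    rw [← mul_one ((N : Matrix (Fin n) (Fin n) ℝ) i j), ← smul_eq_mul, ← smul_single, map_smul]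
    simp [symPartₗ]
  have hd := (hasFDerivAt_last h).fderiv
  have : fderiv ℝ (uncurry4 F) (r, s, p, M) (0, 0, 0, N) = fderiv ℝ (F r s p) M N := by
    rw [hd]; rfl
  rw [this]
  conv_lhs => rw [hN]
  simp only [map_sum, map_smul, trace, diag_apply, mul_apply, gradM, of_apply, smul_eq_mul]
  refine Finset.sum_congr rfl fun i _ => Finset.sum_congr rfl fun j _ => ?_
  rw [hsym i j, mul_comm]

section elliptic
variable {n : ℕ} {ε : ℝ} {F : ℝ → ℝ → E n → SymMat n → ℝ}

theorem differentiableAt_uncurry4 (hF : ContDiffOn ℝ 1 (uncurry4 F) (dom n ε))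
    {q : ℝ × ℝ × E n × SymMat n} (hq : q ∈ dom n ε) : DifferentiableAt ℝ (uncurry4 F) q :=
  (hF.contDiffAt ((isOpen_dom n ε).mem_nhds hq)).differentiableAt (by norm_num)

theorem fderiv_inM_nonpos (hF : ContDiffOn ℝ 1 (uncurry4 F) (dom n ε))
    (hell : ∀ r s : ℝ, 0 < r → r < 1 + ε → ∀ (p : E n) (M : SymMat n), (-gradM F r s p M).PosDef)
    {q : ℝ × ℝ × E n × SymMat n} (hq : q ∈ dom n ε) {N : SymMat n}
    (hN : (N : Matrix (Fin n) (Fin n) ℝ).PosSemidef) :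
    fderiv ℝ (uncurry4 F) q (0, 0, 0, N) ≤ 0 := by
  obtain ⟨r, s, p, M⟩ := q
  rw [fderiv_inM_eq_trace (differentiableAt_uncurry4 hF hq)]
  have := trace_mul_nonneg_of_posSemidef (hell r s hq.1.1 hq.1.2 p M).posSemidef hN
  rw [neg_mul, trace_neg] at this
  linarith

/-- Strictness is needed only in rank one directions: a large multiple of e eᵀ will absorb all lower
order terms. -/
theorem fderiv_inM_outer_neg (hF : ContDiffOn ℝ 1 (uncurry4 F) (dom n ε))
    (hell : ∀ r s : ℝ, 0 < r → r < 1 + ε → ∀ (p : E n) (M : SymMat n), (-gradM F r s p M).PosDef)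
    {q : ℝ × ℝ × E n × SymMat n} (hq : q ∈ dom n ε) {e : E n} (he : e ≠ 0) :
    fderiv ℝ (uncurry4 F) q (0, 0, 0, outer e) < 0 := by
  obtain ⟨r, s, p, M⟩ := q
  rw [fderiv_inM_eq_trace (differentiableAt_uncurry4 hF hq)]
  have he' : e.ofLp ≠ 0 := fun h => he (by ext i; simp [h])
  have := (hell r s hq.1.1 hq.1.2 p M).dotProduct_mulVec_pos he'
  simp only [star_trivial, neg_mulVec, dotProduct_neg] at this
  change (gradM F r s p M * vecMulVec e.ofLp e.ofLp).trace < 0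
  rw [trace_mul_vecMulVec]
  linarith

/-- The mean value theorem on a segment of jets; it takes the place of a linearized equation with
averaged coefficients. -/
theorem exists_apply_add_sub_eq (hF : ContDiffOn ℝ 1 (uncurry4 F) (dom n ε))
    {q k : ℝ × ℝ × E n × SymMat n}
    (hseg : ∀ t ∈ Icc (0 : ℝ) 1, q + t • k ∈ dom n ε) :
    ∃ t ∈ Ioo (0 : ℝ) 1,
      uncurry4 F (q + k) - uncurry4 F q = fderiv ℝ (uncurry4 F) (q + t • k) k := by
  have hder : ∀ t ∈ Icc (0 : ℝ) 1, HasDerivAt (fun t : ℝ => uncurry4 F (q + t • k))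
      (fderiv ℝ (uncurry4 F) (q + t • k) k) t := by
    intro t ht
    have h1 : HasDerivAt (fun t : ℝ => q + t • k) k t := by
      have := ((hasDerivAt_id t).smul_const k).const_add q
      rwa [one_smul] at this
    exact (differentiableAt_uncurry4 hF (hseg t ht)).hasFDerivAt.comp_hasDerivAt t h1
  obtain ⟨c, hc, h⟩ := exists_hasDerivAt_eq_slope (fun t : ℝ => uncurry4 F (q + t • k)) _
    zero_lt_one (fun t ht => (hder t ht).continuousAt.continuousWithinAt)
    (fun t ht => hder t (Ioo_subset_Icc_self ht))
  exact ⟨c, hc, by simpa using h.symm⟩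

/-- Degenerate ellipticity: `F` is nonincreasing in the matrix variable. -/
theorem apply_le_of_quad_le (hF : ContDiffOn ℝ 1 (uncurry4 F) (dom n ε))
    (hell : ∀ r s : ℝ, 0 < r → r < 1 + ε → ∀ (p : E n) (M : SymMat n), (-gradM F r s p M).PosDef)
    {r : ℝ} (hr : r ∈ Ioo 0 (1 + ε)) (s : ℝ) (p : E n) {M N : SymMat n}
    (h : ∀ ξ, quad M ξ ≤ quad N ξ) : F r s p N ≤ F r s p M := by
  have hdom : ∀ t : ℝ, ((r, s, p, M) + t • (0, 0, 0, N - M) : ℝ × ℝ × E n × SymMat n)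
      ∈ dom n ε := by
    intro t
    refine ⟨?_, mem_univ _⟩
    simpa using hr
  obtain ⟨t, -, ht⟩ := exists_apply_add_sub_eq hF (q := (r, s, p, M)) (k := (0, 0, 0, N - M))
    (fun t _ => hdom t)
  have := fderiv_inM_nonpos hF hell (hdom t) (N := N - M)
    (posSemidef_of_quad fun ξ => by rw [quad_sub]; linarith [h ξ])
  rw [← ht] at this
  simpa [uncurry4] using this

end elliptic

/-! ### Hessians as bilinear forms; conditions at a touching point -/

/-- The symmetric matrix of a bilinear form (symmetrized). -/
noncomputable def ofBilin {n : ℕ} (B : E n →L[ℝ] E n →L[ℝ] ℝ) : SymMat n :=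
  symPart (Matrix.of fun i j => B (EuclideanSpace.single i 1) (EuclideanSpace.single j 1))

theorem quad_symPart {n : ℕ} (A : Matrix (Fin n) (Fin n) ℝ) (ξ : E n) :
    quad (symPart A) ξ = ξ.ofLp ⬝ᵥ A *ᵥ ξ.ofLp := by
  have : ξ.ofLp ⬝ᵥ A.transpose *ᵥ ξ.ofLp = ξ.ofLp ⬝ᵥ A *ᵥ ξ.ofLp := by
    rw [mulVec_transpose, dotProduct_comm, dotProduct_mulVec]
  simp only [quad, symPart, smul_mulVec, add_mulVec, dotProduct_smul, dotProduct_add, this,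
    smul_eq_mul]
  ring

theorem bilin_eq_sum {n : ℕ} (B : E n →L[ℝ] E n →L[ℝ] ℝ) (ξ η : E n) :
    B ξ η = ∑ i, ∑ j, ξ i * (B (EuclideanSpace.single i 1) (EuclideanSpace.single j 1) * η j) := by
  have h : ∀ ζ : E n, ζ = ∑ i, ζ i • EuclideanSpace.single i (1 : ℝ) := fun ζ => by
    simpa using ((EuclideanSpace.basisFun (Fin n) ℝ).sum_repr ζ).symm
  conv_lhs => rw [h ξ, h η]
  simp only [map_sum, map_smul, _root_.sum_apply, _root_.smul_apply,
    smul_eq_mul, Finset.mul_sum]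
  rw [Finset.sum_comm]
  refine Finset.sum_congr rfl fun i _ => Finset.sum_congr rfl fun j _ => ?_
  ring

theorem quad_ofBilin {n : ℕ} (B : E n →L[ℝ] E n →L[ℝ] ℝ) (ξ : E n) :
    quad (ofBilin B) ξ = B ξ ξ := by
  rw [ofBilin, quad_symPart, bilin_eq_sum]
  simp [dotProduct, mulVec, Finset.mul_sum]

theorem hessian_eq_ofBilin {n : ℕ} {u : E n → ℝ} {x : E n} (hd : DifferentiableAt ℝ (fderiv ℝ u) x) :
    hessian u x = ofBilin (fderiv ℝ (fderiv ℝ u) x) := by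
  unfold hessian ofBilin
  congr 1
  ext i j
  simp only [hessianMatrix, of_apply]
  rw [fderiv_clm_apply hd (differentiableAt_const _)]
  simp

theorem differentiableAt_fderiv {n : ℕ} {u : E n → ℝ} {x : E n} (hu : ContDiffAt ℝ 2 u x) :
    DifferentiableAt ℝ (fderiv ℝ u) x :=
  (hu.fderiv_right (m := 1) (by norm_num)).differentiableAt (by norm_num)

theorem quad_hessian {n : ℕ} {u : E n → ℝ} {x : E n} (hu : ContDiffAt ℝ 2 u x) (ξ : E n) :
    quad (hessian u x) ξ = fderiv ℝ (fderiv ℝ u) x ξ ξ := by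
  rw [hessian_eq_ofBilin (differentiableAt_fderiv hu), quad_ofBilin]

theorem deriv_eq_and_le_of_isLocalMin {f f' : ℝ → ℝ} {c α β : ℝ}
    (hf : ∀ᶠ t in 𝓝 0, HasDerivAt f (f' t) t) (hf' : HasDerivAt f' c 0)
    (hmin : IsLocalMin (fun t => f t - α * t - β * t ^ 2) 0) : f' 0 = α ∧ 2 * β ≤ c := by
  set g : ℝ → ℝ := fun t => f t - α * t - β * t ^ 2 with hg
  have hg1 : ∀ᶠ t in 𝓝 0, HasDerivAt g (f' t - α - 2 * β * t) t := by
    filter_upwards [hf] with t ht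
    have := (ht.sub ((hasDerivAt_id t).const_mul α)).sub (((hasDerivAt_id t).pow 2).const_mul β)
    exact this.congr_deriv (by simp; ring)
  have hg2 : deriv g =ᶠ[𝓝 0] fun t => f' t - α - 2 * β * t := hg1.mono fun t ht => ht.deriv
  have hg3 : HasDerivAt (fun t => f' t - α - 2 * β * t) (c - 2 * β) 0 := by
    have := (hf'.sub_const α).sub ((hasDerivAt_id (0 : ℝ)).const_mul (2 * β))
    exact this.congr_deriv (by ring)
  have h0 : deriv g 0 = 0 := hmin.deriv_eq_zero
  refine ⟨?_, ?_⟩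
  · have := hg2.self_of_nhds
    rw [h0] at this
    simp at this
    linarith
  -- A negative second derivative would make the minimum a local maximum as well, so the function
  -- would be locally constant with vanishing second derivative.
  · by_contra! hlt
    have hdd : deriv (deriv g) 0 = c - 2 * β := by rw [hg2.deriv_eq, hg3.deriv]
    have hmax : IsLocalMax g 0 := isLocalMax_of_deriv_deriv_neg (by rw [hdd]; linarith) h0
      hg1.self_of_nhds.continuousAt
    have hconst : g =ᶠ[𝓝 0] fun _ => g 0 := by
      filter_upwards [hmin, hmax] with t h1 h2 using le_antisymm h2 h1
    have h1 : deriv g =ᶠ[𝓝 0] fun _ => 0 := by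
      have := hconst.deriv
      simpa using this
    have h2 : deriv (deriv g) 0 = 0 := by
      rw [h1.deriv_eq]; simp
    linarith

theorem ContDiffAt.eventually_hasDerivAt_line {n : ℕ} {w : E n → ℝ} {x : E n}
    (hw : ContDiffAt ℝ 2 w x) (ξ : E n) :
    (∀ᶠ t : ℝ in 𝓝 0, HasDerivAt (fun t : ℝ => w (x + t • ξ)) (fderiv ℝ w (x + t • ξ) ξ) t) ∧
      HasDerivAt (fun t : ℝ => fderiv ℝ w (x + t • ξ) ξ) (fderiv ℝ (fderiv ℝ w) x ξ ξ) 0 := by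
  have hline : ∀ t : ℝ, HasDerivAt (fun t : ℝ => x + t • ξ) ξ t := fun t => by
    have := ((hasDerivAt_id t).smul_const ξ).const_add x
    rwa [one_smul] at this
  have hx : x + (0 : ℝ) • ξ = x := by simp
  constructor
  · have h1 : ∀ᶠ y in 𝓝 (x + (0 : ℝ) • ξ), DifferentiableAt ℝ w y := by
      rw [hx]
      filter_upwards [hw.eventually (by simp)] with y hy using hy.differentiableAt (by norm_num)
    filter_upwards [(hline 0).continuousAt.eventually h1] with t ht
    exact ht.hasFDerivAt.comp_hasDerivAt t (hline t)
  · have h2 := (differentiableAt_fderiv hw).hasFDerivAt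
    rw [← hx] at h2
    have h3 := h2.comp_hasDerivAt (0 : ℝ) (hline 0)
    have h4 := h3.clm_apply (hasDerivAt_const (0 : ℝ) ξ)
    simpa using h4

/-- The quadratic polynomial `⟨b, x - x₁⟩ + K ⟨x - x₁, e⟩² + B |x - x₁|²`. -/
noncomputable def qpoly {n : ℕ} (b e : E n) (K B : ℝ) (x₁ x : E n) : ℝ :=
  inner ℝ b (x - x₁) + K * inner ℝ (x - x₁) e ^ 2 + B * ‖x - x₁‖ ^ 2

/-- First and second order conditions where `v` touches `u + δ q` from above, `q` quadratic. -/
theorem touching {n : ℕ} {u v : E n → ℝ} {x₁ b e : E n} {K B δ : ℝ} (hu : ContDiffAt ℝ 2 u x₁)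
    (hv : ContDiffAt ℝ 2 v x₁)
    (hmin : IsLocalMin (fun x => v x - u x - δ * qpoly b e K B x₁ x) x₁) :
    gradient v x₁ = gradient u x₁ + δ • b ∧
      ∀ ξ, quad (hessian u x₁ + δ • ((2 * K) • outer e + (2 * B) • idMat n)) ξ
        ≤ quad (hessian v x₁) ξ := by
  have key : ∀ ξ : E n, fderiv ℝ v x₁ ξ - fderiv ℝ u x₁ ξ = δ * inner ℝ b ξ ∧
      2 * (δ * (K * inner ℝ ξ e ^ 2 + B * ‖ξ‖ ^ 2)) ≤
        fderiv ℝ (fderiv ℝ v) x₁ ξ ξ - fderiv ℝ (fderiv ℝ u) x₁ ξ ξ := by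
    intro ξ
    obtain ⟨hu1, hu2⟩ := ContDiffAt.eventually_hasDerivAt_line hu ξ
    obtain ⟨hv1, hv2⟩ := ContDiffAt.eventually_hasDerivAt_line hv ξ
    have hx : x₁ + (0 : ℝ) • ξ = x₁ := by simp
    have hcont : Tendsto (fun t : ℝ => x₁ + t • ξ) (𝓝 0) (𝓝 x₁) := by
      have : ContinuousAt (fun t : ℝ => x₁ + t • ξ) 0 := by fun_prop
      simpa [ContinuousAt, hx] using this
    have hm : IsLocalMin (fun t : ℝ => (v (x₁ + t • ξ) - u (x₁ + t • ξ)) - (δ * inner ℝ b ξ) * t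
        - (δ * (K * inner ℝ ξ e ^ 2 + B * ‖ξ‖ ^ 2)) * t ^ 2) 0 := by
      have := hcont.eventually hmin
      filter_upwards [this] with t ht
      simp only [qpoly, hx, add_sub_cancel_left, sub_self, inner_zero_right, inner_zero_left,
        norm_zero, inner_smul_left, inner_smul_right, norm_smul, mul_pow, Real.norm_eq_abs,
        sq_abs, RCLike.conj_to_real] at ht ⊢
      linarith
    have := deriv_eq_and_le_of_isLocalMin (f := fun t : ℝ => v (x₁ + t • ξ) - u (x₁ + t • ξ))
      (f' := fun t : ℝ => fderiv ℝ v (x₁ + t • ξ) ξ - fderiv ℝ u (x₁ + t • ξ) ξ)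
      (by filter_upwards [hu1, hv1] with t h1 h2 using h2.sub h1) (hv2.sub hu2) hm
    simpa only [hx] using this
  refine ⟨?_, fun ξ => ?_⟩
  · have hg : ∀ w : E n → ℝ, ∀ ξ, inner ℝ (gradient w x₁) ξ = fderiv ℝ w x₁ ξ := fun w ξ => by
      simp [gradient]
    refine ext_inner_right ℝ fun ξ => ?_
    rw [inner_add_left, inner_smul_left, hg, hg]
    have := (key ξ).1
    simp only [RCLike.conj_to_real]
    linarith
  · have := (key ξ).2
    rw [quad_add, quad_smul, quad_add, quad_smul, quad_smul, quad_outer, quad_idMat,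
      quad_hessian hu, quad_hessian hv]
    linarith

/-! ### Jets and the no-touching principle -/

/-- The arguments `(|x|, u, ∇u, ∇²u)` of the operator. -/
noncomputable def jet {n : ℕ} (u : E n → ℝ) (x : E n) : ℝ × ℝ × E n × SymMat n :=
  (‖x‖, u x, gradient u x, hessian u x)

instance properSpace_symMat (n : ℕ) : ProperSpace (SymMat n) := FiniteDimensional.proper_real _

section elliptic
variable {n : ℕ} {ε : ℝ} {F : ℝ → ℝ → E n → SymMat n → ℝ}

/-- A supersolution `v` cannot touch `u + δ q` from above, if `q` is a quadratic polynomial that is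
sufficiently convex in one direction and `δ` is small. -/
theorem no_touching (hF : ContDiffOn ℝ 1 (uncurry4 F) (dom n ε))
    (hell : ∀ r s : ℝ, 0 < r → r < 1 + ε → ∀ (p : E n) (M : SymMat n), (-gradM F r s p M).PosDef)
    {e : E n} (he : e ≠ 0) {Q : Set (ℝ × ℝ × E n × SymMat n)} (hQ : IsCompact Q)
    (hQd : Q ⊆ dom n ε) {C : ℝ} (hC : 0 ≤ C) :
    ∃ K₀ : ℝ, ∀ K ≥ K₀, ∃ δ₀ > 0, ∀ (u v : E n → ℝ) (x₁ b : E n) (c B δ : ℝ),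
      ContDiffAt ℝ 2 u x₁ → ContDiffAt ℝ 2 v x₁ → jet u x₁ ∈ Q →
      uncurry4 F (jet u x₁) ≤ uncurry4 F (jet v x₁) → |c| ≤ C → ‖b‖ ≤ C → |B| ≤ C →
      0 < δ → δ < δ₀ → v x₁ = u x₁ + δ * c →
      ¬ IsLocalMin (fun x => v x - u x - δ * qpoly b e K B x₁ x) x₁ := by
  -- A compact neighbourhood of `Q` contains the segments of jets for small δ, so the constants `a`
  -- and `Λ` below are uniform.
  obtain ⟨η, hη, hsub⟩ := hQ.exists_cthickening_subset_open (isOpen_dom n ε) hQd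
  have hcomp : IsCompact (cthickening η Q) := hQ.cthickening
  have hdF : ContinuousOn (fderiv ℝ (uncurry4 F)) (cthickening η Q) :=
    (hF.continuousOn_fderiv_of_isOpen (isOpen_dom n ε) (by norm_num)).mono hsub
  have hout : ContinuousOn (fun q => -fderiv ℝ (uncurry4 F) q (0, 0, 0, outer e))
      (cthickening η Q) := (hdF.clm_apply continuousOn_const).neg
  obtain ⟨a, ha, hae⟩ := hcomp.exists_forall_le' hout (a := 0) fun q hq =>
    neg_pos.2 (fderiv_inM_outer_neg hF hell (hsub hq) he)
  set D : ℝ := C + 2 * C * ‖idMat n‖ with hD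
  have hD0 : 0 ≤ D := by positivity
  have hdFk : ContinuousOn (fun z : (ℝ × ℝ × E n × SymMat n) × (ℝ × ℝ × E n × SymMat n) =>
      fderiv ℝ (uncurry4 F) z.1 z.2) (cthickening η Q ×ˢ closedBall 0 D) :=
    (hdF.comp continuous_fst.continuousOn fun z hz => hz.1).clm_apply continuous_snd.continuousOn
  obtain ⟨Λ, hΛ⟩ := (hcomp.prod (isCompact_closedBall _ _)).exists_bound_of_continuousOn hdFk
  -- The rank one term lowers the derivative of F by at least 2Ka, while value, gradient and
  -- isotropic Hessian raise it by at most |Λ|.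
  refine ⟨(|Λ| + 1) / (2 * a), fun K hK => ?_⟩
  have hKa : |Λ| + 1 ≤ 2 * a * K := by
    have := (div_le_iff₀ (by positivity)).1 hK
    linarith
  set D' : ℝ := D + 2 * |K| * ‖outer e‖ + 1 with hD'
  have hD'0 : 0 < D' := by positivity
  refine ⟨η / D', by positivity, fun u v x₁ b c B δ hu hv hjQ hle hc hb hB hδ hδ₀ hval hmin => ?_⟩
  obtain ⟨hgrad, hhess⟩ := touching hu hv hmin
  -- The jet increment divided by δ, without its e eᵀ part. The radial entry is 0 because both jets
  -- are taken at the same point.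
  set k₁ : ℝ × ℝ × E n × SymMat n := (0, c, b, (2 * B) • idMat n) with hk₁
  set k : ℝ × ℝ × E n × SymMat n := k₁ + (2 * K) • (0, 0, 0, outer e) with hk
  have hk₁n : ‖k₁‖ ≤ D := by
    have h1 : ‖(2 * B) • idMat n‖ ≤ 2 * C * ‖idMat n‖ := by
      rw [norm_smul, Real.norm_eq_abs, abs_mul, abs_two]
      gcongr
    have h2 : 0 ≤ 2 * C * ‖idMat n‖ := by positivity
    refine norm_prod_le_iff.2 ⟨by simpa [hk₁] using hD0, norm_prod_le_iff.2 ⟨?_,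
      norm_prod_le_iff.2 ⟨?_, ?_⟩⟩⟩
    · exact hc.trans (by linarith)
    · exact hb.trans (by linarith)
    · exact h1.trans (by linarith)
  have hkn : ‖k‖ ≤ D' := by
    have h1 : ‖(2 * K) • ((0, 0, 0, outer e) : ℝ × ℝ × E n × SymMat n)‖ = 2 * |K| * ‖outer e‖ := by
      rw [norm_smul, Real.norm_eq_abs, abs_mul, abs_two]
      simp [Prod.norm_def]
    calc ‖k‖ ≤ ‖k₁‖ + ‖(2 * K) • ((0, 0, 0, outer e) : ℝ × ℝ × E n × SymMat n)‖ := norm_add_le _ _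
      _ ≤ D' := by rw [h1]; linarith
  have hmem : ∀ t ∈ Icc (0 : ℝ) 1, jet u x₁ + t • δ • k ∈ cthickening η Q := by
    intro t ht
    refine mem_cthickening_of_dist_le _ (jet u x₁) _ _ hjQ ?_
    rw [dist_self_add_left, norm_smul, norm_smul, Real.norm_of_nonneg ht.1,
      Real.norm_of_nonneg hδ.le]
    have h1 : δ * ‖k‖ ≤ η := by
      have := (lt_div_iff₀ hD'0).1 hδ₀
      nlinarith
    have h2 : 0 ≤ δ * ‖k‖ := by positivity
    nlinarith [ht.2]
  obtain ⟨t, ht, heq⟩ := exists_apply_add_sub_eq hF (q := jet u x₁) (k := δ • k)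
    fun t ht => hsub (hmem t ht)
  have htm := hmem t (Ioo_subset_Icc_self ht)
  have hneg : fderiv ℝ (uncurry4 F) (jet u x₁ + t • δ • k) k < 0 := by
    set A := fderiv ℝ (uncurry4 F) (jet u x₁ + t • δ • k) with hA
    have h1 : A k₁ ≤ |Λ| := (le_abs_self _).trans
      ((hΛ (_, k₁) ⟨htm, by simpa using hk₁n⟩).trans (le_abs_self _))
    have h2 : a ≤ -A (0, 0, 0, outer e) := hae _ htm
    have hKpos : 0 ≤ K := by
      have : 0 < 2 * a * K := by
        have : 0 ≤ |Λ| := by positivity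
        linarith
      nlinarith
    rw [hk, map_add, map_smul, smul_eq_mul]
    nlinarith
  have hlt : uncurry4 F (jet u x₁ + δ • k) < uncurry4 F (jet u x₁) := by
    rw [map_smul, smul_eq_mul] at heq
    nlinarith
  have hadd : jet u x₁ + δ • k = (‖x₁‖, v x₁, gradient v x₁,
      hessian u x₁ + δ • ((2 * K) • outer e + (2 * B) • idMat n)) := by
    rw [hval, hgrad]
    simp [jet, hk, hk₁, add_comm]
  -- The jet of `v` differs from this one only in the Hessian, and in the favourable direction, so
  -- no bound on that Hessian is required.
  have hle2 : uncurry4 F (jet v x₁) ≤ uncurry4 F (jet u x₁ + δ • k) := by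
    rw [hadd]
    exact apply_le_of_quad_le hF hell (hQd hjQ).1 _ _ hhess
  linarith

end elliptic

theorem continuous_ofBilin (n : ℕ) : Continuous (ofBilin (n := n)) := by
  refine Continuous.subtype_mk (f := fun B : E n →L[ℝ] E n →L[ℝ] ℝ => (symPart (Matrix.of fun i j =>
    B (EuclideanSpace.single i 1) (EuclideanSpace.single j 1)) : Matrix (Fin n) (Fin n) ℝ)) ?_ _
  refine continuous_pi fun i => continuous_pi fun j => ?_
  simp only [symPart, Matrix.smul_apply, Matrix.add_apply, transpose_apply, of_apply, smul_eq_mul]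
  exact continuous_const.mul
    (((continuous_id.clm_apply continuous_const).clm_apply continuous_const).add
      ((continuous_id.clm_apply continuous_const).clm_apply continuous_const))

/-- The jet, in terms of the first two derivatives. -/
noncomputable def jetOf {n : ℕ} (z : ℝ × ℝ × (E n →L[ℝ] ℝ) × (E n →L[ℝ] E n →L[ℝ] ℝ)) :
    ℝ × ℝ × E n × SymMat n :=
  (z.1, z.2.1, (InnerProductSpace.toDual ℝ (E n)).symm z.2.2.1, ofBilin z.2.2.2)

theorem continuous_jetOf (n : ℕ) : Continuous (jetOf (n := n)) := by
  have := continuous_ofBilin n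
  unfold jetOf
  fun_prop

theorem jet_eq_jetOf {n : ℕ} {u : E n → ℝ} {x : E n} (hu : ContDiffAt ℝ 2 u x) :
    jet u x = jetOf (‖x‖, u x, fderiv ℝ u x, fderiv ℝ (fderiv ℝ u) x) := by
  simp [jet, jetOf, gradient, hessian_eq_ofBilin (differentiableAt_fderiv hu)]

/-- The jets of a function that is `C²` up to the boundary stay in a compact set. -/
theorem exists_isCompact_jet_mem {n : ℕ} {u : E n → ℝ} {S T : Set (E n)} {ε : ℝ}
    (hS : UniqueDiffOn ℝ S)
    (hu : ContDiffOn ℝ 2 u S) (hT : IsCompact T) (hTS : T ⊆ S)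
    (hTn : ∀ x ∈ T, ‖x‖ ∈ Ioo 0 (1 + ε)) :
    ∃ Q : Set (ℝ × ℝ × E n × SymMat n), IsCompact Q ∧ Q ⊆ dom n ε ∧
      ∀ x ∈ T, x ∈ interior S → jet u x ∈ Q := by
  have hG : ContDiffOn ℝ 1 (fderivWithin ℝ u S) S := hu.fderivWithin hS (by norm_num)
  have hH : ContinuousOn (fderivWithin ℝ (fderivWithin ℝ u S) S) S :=
    hG.continuousOn_fderivWithin hS (by norm_num)
  -- Derivatives within `S` are continuous up to its boundary points, where the full derivatives
  -- need not be; on the interior the two agree.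
  set f : E n → ℝ × ℝ × E n × SymMat n := fun x =>
    jetOf (‖x‖, u x, fderivWithin ℝ u S x, fderivWithin ℝ (fderivWithin ℝ u S) S x) with hf
  have hfc : ContinuousOn f T := by
    refine (continuous_jetOf n).comp_continuousOn ?_
    refine continuous_norm.continuousOn.prodMk ((hu.continuousOn.mono hTS).prodMk
      ((hG.continuousOn.mono hTS).prodMk (hH.mono hTS)))
  refine ⟨f '' T, hT.image_of_continuousOn hfc, ?_, ?_⟩
  · rintro _ ⟨x, hx, rfl⟩
    exact ⟨hTn x hx, mem_univ _⟩
  · intro x hx hxS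
    refine ⟨x, hx, ?_⟩
    have hnhds : S ∈ 𝓝 x := mem_interior_iff_mem_nhds.1 hxS
    rw [jet_eq_jetOf (hu.contDiffAt hnhds)]
    have h1 : ∀ᶠ y in 𝓝 x, fderivWithin ℝ u S y = fderiv ℝ u y := by
      filter_upwards [isOpen_interior.mem_nhds hxS] with y hy
      exact fderivWithin_of_mem_nhds (mem_interior_iff_mem_nhds.1 hy)
    simp only [hf]
    rw [h1.self_of_nhds, fderivWithin_of_mem_nhds hnhds, Filter.EventuallyEq.fderiv_eq h1]

/-! ### Reflections and the reflected equation -/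

section reflection
variable {n : ℕ}

/-- The reflection in the hyperplane `⟨x, e⟩ = l`. -/
noncomputable def refl (e : E n) (l : ℝ) (x : E n) : E n := x - (2 * (inner ℝ x e - l)) • e

/-- The linear part of `refl`. -/
noncomputable def reflL (e : E n) : E n →L[ℝ] E n :=
  ContinuousLinearMap.id ℝ (E n) - (2 : ℝ) • (innerSL ℝ e).smulRight e

/-- The matrix of `reflL`. -/
def reflM (e : E n) : Matrix (Fin n) (Fin n) ℝ := 1 - (2 : ℝ) • vecMulVec e e

theorem reflL_apply (e x : E n) : reflL e x = x - (2 * inner ℝ x e) • e := by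
  simp [reflL, real_inner_comm, smul_smul]

theorem refl_eq (e : E n) (l : ℝ) (x : E n) : refl e l x = reflL e x + (2 * l) • e := by
  rw [refl, reflL_apply, mul_sub, sub_smul]
  abel

theorem inner_reflL (e x y : E n) : inner ℝ (reflL e x) y = inner ℝ x (reflL e y) := by
  rw [reflL_apply, reflL_apply, inner_sub_left, inner_sub_right, inner_smul_left, inner_smul_right,
    real_inner_comm y e]
  simp only [RCLike.conj_to_real]
  ring

theorem continuous_refl (e : E n) (l : ℝ) : Continuous (refl e l) := by
  unfold refl
  fun_prop

theorem contDiff_refl (e : E n) (l : ℝ) : ContDiff ℝ 2 (refl e l) := by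
  rw [show refl e l = fun x => reflL e x + (2 * l) • e from funext (refl_eq e l)]
  exact (reflL e).contDiff.add contDiff_const

theorem refl_zero (e : E n) (l : ℝ) : refl e l 0 = (2 * l) • e := by
  simp [refl]

theorem refl_of_inner_eq {e x : E n} {l : ℝ} (h : inner ℝ x e = l) : refl e l x = x := by
  simp [refl, h]

variable {e : E n} (he : ‖e‖ = 1)
include he

theorem inner_self_of_unit : inner ℝ e e = (1 : ℝ) := by
  rw [real_inner_self_eq_norm_sq, he, one_pow]

theorem reflL_reflL (x : E n) : reflL e (reflL e x) = x := by
  simp only [reflL_apply, inner_sub_left, inner_smul_left, inner_self_of_unit he,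
    RCLike.conj_to_real]
  rw [sub_sub, ← add_smul]
  ring_nf
  simp

theorem norm_reflL (x : E n) : ‖reflL e x‖ = ‖x‖ := by
  rw [← sq_eq_sq₀ (norm_nonneg _) (norm_nonneg _), ← real_inner_self_eq_norm_sq, inner_reflL,
    reflL_reflL he, real_inner_self_eq_norm_sq]

theorem inner_refl (l : ℝ) (x : E n) : inner ℝ (refl e l x) e = 2 * l - inner ℝ x e := by
  simp only [refl, inner_sub_left, inner_smul_left, inner_self_of_unit he, RCLike.conj_to_real]
  ring

theorem refl_refl (l : ℝ) (x : E n) : refl e l (refl e l x) = x := by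
  conv_lhs => rw [refl, inner_refl he]
  rw [refl, sub_sub, ← add_smul]
  ring_nf
  simp

theorem norm_refl_sq (l : ℝ) (x : E n) :
    ‖refl e l x‖ ^ 2 = ‖x‖ ^ 2 - 4 * l * (inner ℝ x e - l) := by
  rw [refl, norm_sub_sq_real, inner_smul_right, norm_smul, he, mul_one, Real.norm_eq_abs, sq_abs]
  ring

theorem norm_refl_le {l : ℝ} (hl : 0 ≤ l) {x : E n} (hx : l ≤ inner ℝ x e) :
    ‖refl e l x‖ ≤ ‖x‖ := by
  have := norm_refl_sq he l x
  have h2 : 0 ≤ 4 * l * (inner ℝ x e - l) := by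
    have : 0 ≤ inner ℝ x e - l := by linarith
    positivity
  exact le_of_sq_le_sq (by linarith) (norm_nonneg _)

theorem norm_refl_lt {l : ℝ} (hl : 0 < l) {x : E n} (hx : l < inner ℝ x e) :
    ‖refl e l x‖ < ‖x‖ := by
  have := norm_refl_sq he l x
  have h2 : 0 < 4 * l * (inner ℝ x e - l) := by
    have : 0 < inner ℝ x e - l := by linarith
    positivity
  exact lt_of_pow_lt_pow_left₀ 2 (norm_nonneg _) (by linarith)

theorem refl_eq_zero_iff {l : ℝ} {x : E n} : refl e l x = 0 ↔ x = (2 * l) • e := by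
  constructor
  · intro h
    rw [← refl_refl he l x, h, refl_zero]
  · rintro rfl
    rw [← refl_zero, refl_refl he]

theorem reflM_mem : reflM e ∈ Matrix.orthogonalGroup (Fin n) ℝ := by
  rw [mem_orthogonalGroup_iff]
  have h1 : e.ofLp ⬝ᵥ e.ofLp = 1 := by
    rw [← inner_self_of_unit he, PiLp.inner_apply]
    simp [dotProduct, sq]
  have ht : (reflM e).transpose = reflM e := by
    rw [reflM]
    simp [transpose_sub, transpose_smul, transpose_vecMulVec]
  rw [ht, reflM]
  simp only [sub_mul, mul_sub, smul_mul_smul, vecMulVec_mul_vecMulVec, h1, Matrix.one_mul,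
    Matrix.mul_one, one_smul]
  ext i j
  simp
  ring

omit he in
theorem act_reflM (p : E n) : act (reflM e) p = reflL e p := by
  rw [reflL_apply]
  ext i
  simp only [act, reflM, sub_mulVec, smul_mulVec, vecMulVec_mulVec, one_mulVec]
  simp [PiLp.inner_apply, dotProduct]
  ring_nf

omit he in
theorem act_reflM_transpose (p : E n) : act (reflM e).transpose p = reflL e p := by
  rw [← act_reflM]
  simp [reflM, transpose_sub, transpose_smul, transpose_vecMulVec]

omit he in
theorem quad_conj (O : Matrix (Fin n) (Fin n) ℝ) (M : SymMat n) (ξ : E n) :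
    quad (conj O M) ξ = quad M (act O ξ) := by
  simp only [quad, conj, act]
  rw [← mulVec_mulVec, ← mulVec_mulVec, dotProduct_mulVec, vecMul_transpose]

omit he in
theorem fderiv_comp_refl {u : E n → ℝ} {l : ℝ} {x : E n}
    (hu : DifferentiableAt ℝ u (refl e l x)) :
    fderiv ℝ (fun y => u (refl e l y)) x = (fderiv ℝ u (refl e l x)).comp (reflL e) := by
  have h1 : HasFDerivAt (refl e l) (reflL e) x := by
    have h2 : refl e l = fun y => reflL e y + (2 * l) • e := funext fun y => refl_eq e l y
    rw [h2]
    exact (reflL e).hasFDerivAt.add_const _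
  exact (hu.hasFDerivAt.comp x h1).fderiv

omit he in
theorem gradient_comp_refl {u : E n → ℝ} {l : ℝ} {x : E n}
    (hu : DifferentiableAt ℝ u (refl e l x)) :
    gradient (fun y => u (refl e l y)) x = reflL e (gradient u (refl e l x)) := by
  refine ext_inner_right ℝ fun ξ => ?_
  rw [inner_reflL]
  simp [gradient, fderiv_comp_refl hu]

omit he in
theorem contDiffAt_comp_refl {u : E n → ℝ} {l : ℝ} {x : E n}
    (hu : ContDiffAt ℝ 2 u (refl e l x)) : ContDiffAt ℝ 2 (fun y => u (refl e l y)) x :=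
  hu.comp x (contDiff_refl e l).contDiffAt

omit he in
theorem quad_hessian_comp_refl {u : E n → ℝ} {l : ℝ} {x : E n}
    (hu : ContDiffAt ℝ 2 u (refl e l x)) (ξ : E n) :
    quad (hessian (fun y => u (refl e l y)) x) ξ = quad (hessian u (refl e l x)) (reflL e ξ) := by
  rw [quad_hessian hu, quad_hessian (contDiffAt_comp_refl hu)]
  have h1 : ∀ᶠ y in 𝓝 x, fderiv ℝ (fun y => u (refl e l y)) y
      = (fderiv ℝ u (refl e l y)).comp (reflL e) := by
    filter_upwards [(continuous_refl e l).continuousAt.eventually (hu.eventually (by simp))]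
      with y hy
    exact fderiv_comp_refl (hy.differentiableAt (by norm_num))
  rw [Filter.EventuallyEq.fderiv_eq h1]
  have h3 : HasFDerivAt (refl e l) (reflL e) x := by
    have h2 : refl e l = fun y => reflL e y + (2 * l) • e := funext fun y => refl_eq e l y
    rw [h2]
    exact (reflL e).hasFDerivAt.add_const _
  have h4 := ((differentiableAt_fderiv hu).hasFDerivAt.comp x h3).clm_comp
    (hasFDerivAt_const (reflL e) x)
  have h5 := h4.fderiv
  simp only [Function.comp_def] at h5
  rw [h5]
  simp

/-- The reflected function is a supersolution on the far side of the hyperplane. -/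
theorem jet_comp_refl_nonneg {ε : ℝ} (hε : 0 < ε) {F : ℝ → ℝ → E n → SymMat n → ℝ}
    (hF : ContDiffOn ℝ 1 (uncurry4 F) (dom n ε))
    (hell : ∀ r s : ℝ, 0 < r → r < 1 + ε → ∀ (p : E n) (M : SymMat n), (-gradM F r s p M).PosDef)
    (hmono : ∀ r s : ℝ, 0 < r → r < 1 + ε → 0 < s → ∀ (p : E n) (M : SymMat n),
      0 ≤ deriv (fun ρ => F ρ s p M) r)
    (hinv : ∀ r s : ℝ, 0 < r → r < 1 + ε → 0 < s → ∀ (p : E n) (M : SymMat n)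
      (O : Matrix (Fin n) (Fin n) ℝ), O ∈ Matrix.orthogonalGroup (Fin n) ℝ →
      F r s (act O.transpose p) (conj O M) = F r s p M)
    {u : E n → ℝ} {l : ℝ} {x : E n} (hu : ContDiffAt ℝ 2 u (refl e l x))
    (hpos : 0 < u (refl e l x)) (heq : uncurry4 F (jet u (refl e l x)) = 0)
    (hne : refl e l x ≠ 0) (hle : ‖refl e l x‖ ≤ ‖x‖) (hx : ‖x‖ < 1) :
    0 ≤ uncurry4 F (jet (fun y => u (refl e l y)) x) := by
  have h0 : 0 < ‖refl e l x‖ := norm_pos_iff.2 hne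
  have hr : ‖x‖ ∈ Ioo 0 (1 + ε) := ⟨by linarith, by linarith⟩
  set s := u (refl e l x) with hs
  set p := gradient u (refl e l x) with hp
  set M := hessian u (refl e l x) with hM
  have h1 : uncurry4 F (jet (fun y => u (refl e l y)) x) =
      F ‖x‖ s (act (reflM e).transpose p) (conj (reflM e) M) := by
    simp only [uncurry4, jet, gradient_comp_refl (hu.differentiableAt (by norm_num)),
      act_reflM_transpose]
    -- Equal quadratic forms suffice: monotonicity of F in the matrix, used both ways, gives equal
    -- values.
    have hq : ∀ ξ, quad (hessian (fun y => u (refl e l y)) x) ξ = quad (conj (reflM e) M) ξ := by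
      intro ξ
      rw [quad_hessian_comp_refl hu, quad_conj, act_reflM]
    exact le_antisymm (apply_le_of_quad_le hF hell hr _ _ fun ξ => (hq ξ).ge)
      (apply_le_of_quad_le hF hell hr _ _ fun ξ => (hq ξ).le)
  rw [h1, hinv _ _ hr.1 hr.2 hpos _ _ _ (reflM_mem he)]
  have hd : ∀ r ∈ Ioo 0 (1 + ε), DifferentiableAt ℝ (fun ρ => F ρ s p M) r := by
    intro r hr
    have h2 : DifferentiableAt ℝ (uncurry4 F) (r, s, p, M) :=
      differentiableAt_uncurry4 hF ⟨hr, mem_univ _⟩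
    have h3 : DifferentiableAt ℝ (fun ρ : ℝ => ((ρ, s, p, M) : ℝ × ℝ × E n × SymMat n)) r :=
      differentiableAt_id.prodMk (differentiableAt_const _)
    exact DifferentiableAt.comp (g := uncurry4 F) r h2 h3
  have hmonoOn : MonotoneOn (fun ρ => F ρ s p M) (Ioo 0 (1 + ε)) := by
    refine monotoneOn_of_deriv_nonneg (convex_Ioo _ _)
      (fun r hr => (hd r hr).continuousAt.continuousWithinAt) ?_ ?_
    · rw [interior_Ioo]
      exact fun r hr => (hd r hr).differentiableWithinAt
    · rw [interior_Ioo]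
      exact fun r hr => hmono r s hr.1 hr.2 hpos p M
  calc (0 : ℝ) = F ‖refl e l x‖ s p M := heq.symm
    _ ≤ F ‖x‖ s p M := hmonoOn ⟨h0, by linarith⟩ hr hle

end reflection

/-! ### Hopf lemma and strong maximum principle -/

theorem le_of_eventually_mul_le {g : ℝ → ℝ} {c d : ℝ} (hg : HasDerivAt g d 0) (h0 : g 0 = 0)
    (h : ∀ᶠ t in 𝓝[>] 0, c * t ≤ g t) : c ≤ d := by
  have h1 : Tendsto (fun t : ℝ => t⁻¹ * g t) (𝓝[>] 0) (𝓝 d) := by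
    simpa [h0] using hg.tendsto_slope_zero_right
  refine ge_of_tendsto h1 ?_
  filter_upwards [h, self_mem_nhdsWithin] with t ht (ht0 : 0 < t)
  rw [inv_mul_eq_div, le_div_iff₀ ht0]
  exact ht

/-- Supplies the compact set of jets demanded by `no_touching` near an interior point. -/
theorem exists_closedBall_jet_mem {n : ℕ} {u : E n → ℝ} {x₀ : E n} {ε : ℝ}
    (hu : ContDiffAt ℝ 2 u x₀) (hx₀ : ‖x₀‖ ∈ Ioo 0 (1 + ε)) :
    ∃ ρ > 0, ∃ Q : Set (ℝ × ℝ × E n × SymMat n), IsCompact Q ∧ Q ⊆ dom n ε ∧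
      ∀ x ∈ closedBall x₀ ρ, ContDiffAt ℝ 2 u x ∧ jet u x ∈ Q := by
  have h1 : ∀ᶠ x in 𝓝 x₀, ContDiffAt ℝ 2 u x ∧ ‖x‖ ∈ Ioo 0 (1 + ε) :=
    (hu.eventually (by simp)).and
      (continuous_norm.continuousAt.eventually (isOpen_Ioo.mem_nhds hx₀))
  obtain ⟨r, hr, hb⟩ := Metric.eventually_nhds_iff_ball.1 h1
  have hsub : closedBall x₀ (r / 2) ⊆ ball x₀ r := closedBall_subset_ball (by linarith)
  obtain ⟨Q, hQ, hQd, hQm⟩ := exists_isCompact_jet_mem (u := u) (S := ball x₀ r)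
    (T := closedBall x₀ (r / 2)) (ε := ε) isOpen_ball.uniqueDiffOn
    (fun x hx => (hb x hx).1.contDiffWithinAt) (isCompact_closedBall _ _) hsub
    (fun x hx => (hb x (hsub hx)).2)
  refine ⟨r / 2, by positivity, Q, hQ, hQd, fun x hx => ⟨(hb x (hsub hx)).1, hQm x hx ?_⟩⟩
  rw [isOpen_ball.interior_eq]
  exact hsub hx

theorem abs_inner_le_of_unit {n : ℕ} {e : E n} (he : ‖e‖ = 1) (x : E n) : |inner ℝ x e| ≤ ‖x‖ := by
  simpa [he] using abs_real_inner_le_norm x e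

section elliptic
variable {n : ℕ} {ε : ℝ} {F : ℝ → ℝ → E n → SymMat n → ℝ}

/-- The Hopf lemma. -/
theorem hopf (hF : ContDiffOn ℝ 1 (uncurry4 F) (dom n ε))
    (hell : ∀ r s : ℝ, 0 < r → r < 1 + ε → ∀ (p : E n) (M : SymMat n), (-gradM F r s p M).PosDef)
    {u v : E n → ℝ} {x₀ ν : E n} {R : ℝ} (hR : 0 < R) (hν : ‖ν‖ = 1)
    (hx₀ : ‖x₀‖ ∈ Ioo 0 (1 + ε)) (hu : ContDiffAt ℝ 2 u x₀) (hv : ContDiffAt ℝ 2 v x₀)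
    (hcmp : ∀ᶠ x in 𝓝 x₀, x ∈ ball (x₀ + R • ν) R →
      uncurry4 F (jet u x) ≤ uncurry4 F (jet v x) ∧ u x < v x)
    (heq : v x₀ = u x₀) :
    ∃ c > 0, ∀ᶠ t : ℝ in 𝓝[>] 0, c * t ≤ v (x₀ + t • ν) - u (x₀ + t • ν) := by
  have hν0 : ν ≠ 0 := fun h => by simp [h] at hν
  have hνν : inner ℝ ν ν = (1 : ℝ) := by rw [real_inner_self_eq_norm_sq, hν, one_pow]
  obtain ⟨ρ₁, hρ₁, Q, hQ, hQd, hQm⟩ := exists_closedBall_jet_mem hu hx₀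
  obtain ⟨ρ₂, hρ₂, hcv⟩ := Metric.eventually_nhds_iff_ball.1 (hcmp.and (hv.eventually (by simp)))
  -- With this k, h ≥ 0 together with K s² ≤ s forces |x - x₀|² ≤ R s, so `D` lies in the open ball
  -- except for the point `x₀`. Taking K ≥ k makes h at least t along the normal.
  set k : ℝ := 2 / R with hk
  have hk0 : 0 < k := by positivity
  obtain ⟨K₀, hNT⟩ := no_touching hF hell hν0 hQ hQd (C := 3 + k) (by positivity)
  set K : ℝ := max K₀ k with hK
  have hKk : k ≤ K := le_max_right _ _
  have hK0 : 0 < K := hk0.trans_le hKk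
  obtain ⟨δ₀, hδ₀, hNT⟩ := hNT K (le_max_left _ _)
  obtain ⟨ρ, hρ, hρ1, hρρ₁, hρρ₂, hρK⟩ : ∃ ρ : ℝ, 0 < ρ ∧ ρ ≤ 1 ∧ ρ ≤ ρ₁ ∧ ρ < ρ₂ ∧
      2 * K * ρ ≤ 1 := by
    refine ⟨min (min 1 ρ₁) (min (ρ₂ / 2) (1 / (2 * K))), by positivity, ?_, ?_, ?_, ?_⟩
    · exact (min_le_left _ _).trans (min_le_left _ _)
    · exact (min_le_left _ _).trans (min_le_right _ _)
    · exact ((min_le_right _ _).trans (min_le_left _ _)).trans_lt (by linarith)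
    · have := (min_le_right (min 1 ρ₁) (min (ρ₂ / 2) (1 / (2 * K)))).trans (min_le_right _ _)
      rw [le_div_iff₀ (by positivity)] at this
      linarith
  set s : E n → ℝ := fun x => inner ℝ (x - x₀) ν with hs
  set h : E n → ℝ := fun x => s x + K * s x ^ 2 - k * ‖x - x₀‖ ^ 2 with hh
  have hsc : Continuous s := by fun_prop
  have hhc : Continuous h := by fun_prop
  set D : Set (E n) := closedBall x₀ ρ ∩ {x | 0 ≤ s x ∧ 0 ≤ h x} with hD
  have hDc : IsCompact D := (isCompact_closedBall _ _).inter_right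
    ((isClosed_le continuous_const hsc).inter (isClosed_le continuous_const hhc))
  have hsle : ∀ x ∈ closedBall x₀ ρ, |s x| ≤ ρ := fun x hx =>
    (abs_inner_le_of_unit hν _).trans (by simpa [dist_eq_norm] using hx)
  have hDball : ∀ x ∈ D, x ≠ x₀ → x ∈ ball (x₀ + R • ν) R ∧ 0 < s x := by
    rintro x ⟨hxρ, hsx, hhx⟩ hne
    have h1 := (abs_le.1 (hsle x hxρ)).2
    have h2 : 0 < ‖x - x₀‖ ^ 2 := by
      have := norm_pos_iff.2 (sub_ne_zero.2 hne)
      positivity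
    have h3 : k * ‖x - x₀‖ ^ 2 ≤ 2 * s x := by
      have h4 : K * s x ^ 2 ≤ s x := by
        nlinarith
      simp only [hh] at hhx
      linarith
    have h5 : ‖x - x₀‖ ^ 2 ≤ R * s x := by
      rw [hk, div_mul_eq_mul_div, div_le_iff₀ hR] at h3
      linarith
    have h6 : 0 < s x := by
      by_contra! hc
      nlinarith
    refine ⟨?_, h6⟩
    rw [mem_ball, dist_eq_norm]
    have h7 : x - (x₀ + R • ν) = (x - x₀) - R • ν := by abel
    have h8 : ‖x - (x₀ + R • ν)‖ ^ 2 = ‖x - x₀‖ ^ 2 - 2 * (R * s x) + R ^ 2 := by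
      rw [h7, norm_sub_sq_real, inner_smul_right, norm_smul, hν, mul_one, Real.norm_eq_abs, sq_abs]
    refine lt_of_pow_lt_pow_left₀ 2 hR.le ?_
    have : 0 < R * s x := by positivity
    linarith
  have hDcmp : ∀ x ∈ D, x ≠ x₀ → uncurry4 F (jet u x) ≤ uncurry4 F (jet v x) ∧ u x < v x :=
    fun x hx hne => (hcv x (closedBall_subset_ball hρρ₂ hx.1)).1 (hDball x hx hne).1
  have hcu : ∀ x ∈ closedBall x₀ ρ, ContDiffAt ℝ 2 u x ∧ jet u x ∈ Q := fun x hx =>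
    hQm x (closedBall_subset_closedBall hρρ₁ hx)
  have hcv' : ∀ x ∈ closedBall x₀ ρ, ContDiffAt ℝ 2 v x := fun x hx =>
    (hcv x (closedBall_subset_ball hρρ₂ hx)).2
  have hwc : ContinuousOn (fun x => v x - u x) D := fun x hx =>
    ((hcv' x hx.1).continuousAt.sub (hcu x hx.1).1.continuousAt).continuousWithinAt
  obtain ⟨m, hm, hmle⟩ := (hDc.inter_right (isClosed_sphere (x := x₀) (ε := ρ))).exists_forall_le'
    (f := fun x => v x - u x) (a := 0) (hwc.mono inter_subset_left) (fun x hx => by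
      have hne : x ≠ x₀ := by
        rintro rfl
        have := hx.2
        simp at this
        linarith
      exact sub_pos.2 (hDcmp x hx.1 hne).2)
  set δ : ℝ := min (δ₀ / 2) (m / 3) with hδ
  have hδ0 : 0 < δ := by positivity
  have hδ1 : δ < δ₀ := (min_le_left _ _).trans_lt (by linarith)
  have hδ2 : δ ≤ m / 3 := min_le_right _ _
  have hhle : ∀ x ∈ D, h x ≤ 2 := by
    rintro x ⟨hxρ, hsx, hhx⟩
    have h1 := (abs_le.1 (hsle x hxρ)).2
    have h4 : K * s x ^ 2 ≤ s x := by nlinarith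
    have h5 : 0 ≤ k * ‖x - x₀‖ ^ 2 := by positivity
    simp only [hh]
    linarith
  have hwD : ∀ x ∈ D, 0 ≤ v x - u x := by
    intro x hx
    by_cases hne : x = x₀
    · rw [hne, heq, sub_self]
    · exact (sub_pos.2 (hDcmp x hx hne).2).le
  have main : ∀ x ∈ D, δ * h x ≤ v x - u x := by
    by_contra! hcon
    obtain ⟨x', hx', hlt'⟩ := hcon
    obtain ⟨x₁, hx₁, hmin⟩ := hDc.exists_isMinOn ⟨x', hx'⟩
      (f := fun x => v x - u x - δ * h x) (hwc.sub (hhc.continuousOn.const_mul δ))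
    have hlt : v x₁ - u x₁ < δ * h x₁ := by
      have := hmin hx'
      simp only [mem_ofPred_eq] at this
      linarith
    have hw₁ := hwD x₁ hx₁
    have hh₁ : 0 < h x₁ := by
      by_contra! hc
      nlinarith
    have hne : x₁ ≠ x₀ := by
      rintro rfl
      simp [hh, hs] at hh₁
    have hs₁ := (hDball x₁ hx₁ hne).2
    have hh₂ := hhle x₁ hx₁
    have hρ₁' : dist x₁ x₀ < ρ := by
      refine lt_of_le_of_ne hx₁.1 fun hd => ?_
      have := hmle x₁ ⟨hx₁, hd⟩
      nlinarith
    have hnhds : D ∈ 𝓝 x₁ := by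
      filter_upwards [isOpen_ball.mem_nhds (mem_ball.2 hρ₁'),
        hsc.continuousAt.eventually (lt_mem_nhds hs₁),
        hhc.continuousAt.eventually (lt_mem_nhds hh₁)] with x h1 h2 h3
      exact ⟨ball_subset_closedBall h1, h2.le, h3.le⟩
    set b : E n := (1 + 2 * K * s x₁) • ν - (2 * k) • (x₁ - x₀) with hb
    -- The barrier is quadratic, so its expansion at x₁ is exact and of the form treated by
    -- `no_touching`.
    have hexp : ∀ x, h x = h x₁ + qpoly b ν K (-k) x₁ x := by
      intro x
      have h1 : x - x₀ = (x - x₁) + (x₁ - x₀) := by abel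
      simp only [hh, hs, qpoly, hb, h1, inner_sub_left, inner_smul_left,
        norm_add_sq_real, RCLike.conj_to_real, real_inner_comm (x - x₁) ν,
        real_inner_comm (x - x₁) (x₁ - x₀)]
      ring
    have hx₁n : ‖x₁ - x₀‖ ≤ ρ := by rw [← dist_eq_norm]; exact hρ₁'.le
    have hsρ := (abs_le.1 (hsle x₁ hx₁.1)).2
    refine hNT u v x₁ b ((v x₁ - u x₁) / δ) (-k) δ (hcu x₁ hx₁.1).1 (hcv' x₁ hx₁.1)
      (hcu x₁ hx₁.1).2 (hDcmp x₁ hx₁ hne).1 ?_ ?_ ?_ hδ0 hδ1 ?_ ?_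
    · rw [abs_of_nonneg (by positivity), div_le_iff₀ hδ0]
      nlinarith
    · have h1 : ‖b‖ ≤ (1 + 2 * K * s x₁) + 2 * k * ‖x₁ - x₀‖ := by
        refine (norm_sub_le _ _).trans ?_
        rw [norm_smul, norm_smul, hν, mul_one, Real.norm_of_nonneg (by positivity),
          Real.norm_of_nonneg (by positivity)]
      nlinarith
    · rw [abs_neg, abs_of_pos hk0]
      linarith
    · field_simp
      ring
    · filter_upwards [hnhds] with x hx
      have h1 := hmin hx
      simp only [mem_ofPred_eq] at h1
      rw [hexp x] at h1
      have h2 : qpoly b ν K (-k) x₁ x₁ = 0 := by simp [qpoly]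
      rw [h2]
      linarith
  refine ⟨δ, hδ0, ?_⟩
  filter_upwards [Ioo_mem_nhdsGT hρ] with t ht
  have hst : s (x₀ + t • ν) = t := by
    simp only [hs, add_sub_cancel_left, inner_smul_left, hνν]
    simp
  have hht : t ≤ h (x₀ + t • ν) := by
    simp only [hh, hst, add_sub_cancel_left, norm_smul, hν, mul_one, Real.norm_eq_abs, sq_abs]
    nlinarith [sq_nonneg t]
  have := main (x₀ + t • ν) ⟨by
    rw [mem_closedBall, dist_self_add_left, norm_smul, hν, mul_one, Real.norm_of_nonneg ht.1.le]
    exact ht.2.le, by rw [hst]; exact ht.1.le, ht.1.le.trans hht⟩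
  nlinarith

/-- The strong maximum principle, in local form. -/
theorem eventually_eq_of_touch (hF : ContDiffOn ℝ 1 (uncurry4 F) (dom n ε))
    (hell : ∀ r s : ℝ, 0 < r → r < 1 + ε → ∀ (p : E n) (M : SymMat n), (-gradM F r s p M).PosDef)
    {u v : E n → ℝ} {x₀ : E n}
    (h : ∀ᶠ x in 𝓝 x₀, ‖x‖ ∈ Ioo 0 (1 + ε) ∧ ContDiffAt ℝ 2 u x ∧ ContDiffAt ℝ 2 v x ∧
      uncurry4 F (jet u x) ≤ uncurry4 F (jet v x) ∧ u x ≤ v x)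
    (heq : v x₀ = u x₀) : ∀ᶠ x in 𝓝 x₀, v x = u x := by
  obtain ⟨r, hr, hb⟩ := Metric.eventually_nhds_iff_ball.1 h
  -- The ball about z reaching to the nearest coincidence point has radius below r/3, hence stays
  -- within 2r/3 of x₀, where coincidences are recorded in `Z`.
  refine Metric.eventually_nhds_iff_ball.2 ⟨r / 3, by positivity, fun z hz => ?_⟩
  by_contra hne
  have hsub : closedBall x₀ (2 * r / 3) ⊆ ball x₀ r := closedBall_subset_ball (by linarith)
  have hwc : ContinuousOn (fun x => v x - u x) (closedBall x₀ (2 * r / 3)) := fun x hx =>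
    ((hb x (hsub hx)).2.2.1.continuousAt.sub
      (hb x (hsub hx)).2.1.continuousAt).continuousWithinAt
  set Z : Set (E n) := closedBall x₀ (2 * r / 3) ∩ (fun x => v x - u x) ⁻¹' {0} with hZ
  have hZc : IsCompact Z := (isCompact_closedBall _ _).of_isClosed_subset
    (hwc.preimage_isClosed_of_isClosed isClosed_closedBall isClosed_singleton) inter_subset_left
  have hx₀Z : x₀ ∈ Z := ⟨mem_closedBall_self (by positivity), by simp [heq]⟩
  obtain ⟨x₁, hx₁, hmin⟩ := hZc.exists_isMinOn ⟨x₀, hx₀Z⟩ (f := fun x => dist z x)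
    (by fun_prop)
  set R := dist z x₁ with hR
  have hRr : R < r / 3 := (hmin hx₀Z).trans_lt (mem_ball.1 hz)
  have heq₁ : v x₁ = u x₁ := sub_eq_zero.1 hx₁.2
  have hzx : z ≠ x₁ := by
    rintro rfl
    exact hne heq₁
  have hR0 : 0 < R := dist_pos.2 hzx
  have hx₁b := hsub hx₁.1
  set ν : E n := R⁻¹ • (z - x₁) with hν
  have hν1 : ‖ν‖ = 1 := by
    rw [hν, norm_smul, ← dist_eq_norm, ← hR, Real.norm_of_nonneg (by positivity)]
    field_simp
  have hcenter : x₁ + R • ν = z := by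
    rw [hν, smul_smul, mul_inv_cancel₀ hR0.ne', one_smul]
    abel
  obtain ⟨hn₁, hu₁, hv₁, -, -⟩ := hb x₁ hx₁b
  obtain ⟨c, hc, hct⟩ := hopf hF hell hR0 hν1 hn₁ hu₁ hv₁ (by
    rw [hcenter]
    filter_upwards [isOpen_ball.mem_nhds hx₁b] with x hx hxz
    obtain ⟨-, -, -, h1, h2⟩ := hb x hx
    refine ⟨h1, lt_of_le_of_ne h2 fun h3 => ?_⟩
    have hxZ : x ∈ Z := by
      refine ⟨?_, by simp [h3]⟩
      have := dist_triangle x z x₀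
      rw [mem_ball] at hxz hz
      rw [mem_closedBall]
      linarith
    have := hmin hxZ
    simp only [mem_ofPred_eq] at this
    rw [mem_ball, dist_comm] at hxz
    linarith) heq₁
  have hdw : HasFDerivAt (fun x => v x - u x) (fderiv ℝ (fun x => v x - u x) x₁) x₁ :=
    ((hv₁.differentiableAt (by norm_num)).sub (hu₁.differentiableAt (by norm_num))).hasFDerivAt
  -- The coincidence point is an interior minimum, so the derivative vanishes there, against the
  -- positive slope from the Hopf lemma.
  have hlm : IsLocalMin (fun x => v x - u x) x₁ := by
    filter_upwards [isOpen_ball.mem_nhds hx₁b] with x hx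
    rw [heq₁, sub_self]
    exact sub_nonneg.2 (hb x hx).2.2.2.2
  rw [hlm.fderiv_eq_zero] at hdw
  have hline : HasDerivAt (fun t : ℝ => x₁ + t • ν) ν 0 := by
    have := ((hasDerivAt_id (0 : ℝ)).smul_const ν).const_add x₁
    rwa [one_smul] at this
  have hx : x₁ + (0 : ℝ) • ν = x₁ := by simp
  rw [← hx] at hdw
  have hd0 := hdw.comp_hasDerivAt (0 : ℝ) hline
  have := le_of_eventually_mul_le hd0 (by simp [heq₁]) hct
  simp at this
  linarith

end elliptic

/-! ### Comparison across an isolated singularity -/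

/-- If the graph of `v - ψ` lies above a cone, but `v` stays above its affine minorants, then `v - ψ`
does not come close to the vertex of the cone. -/
theorem exists_add_le_of_cone {n : ℕ} {v ψ : E n → ℝ} {y : E n} {r η τ rbar : ℝ} (hr : 0 < r)
    (hη : 0 < η) (hrbar : 0 < rbar)
    (hsuper : ∀ (V : E n) (c ρ : ℝ), 0 < ρ → ρ < rbar →
      (∀ x ∈ sphere y ρ, c ≤ v x + inner ℝ V (x - y)) →
      ∀ x ∈ ball y ρ \ {y}, c ≤ v x + inner ℝ V (x - y))
    (hψ : DifferentiableAt ℝ ψ y)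
    (cone : ∀ x ∈ closedBall y r \ {y}, τ + η * ‖x - y‖ ≤ v x - ψ x) :
    ∃ θ > 0, ∀ x ∈ closedBall y r \ {y}, τ + θ ≤ v x - ψ x := by
  set p : E n := gradient ψ y with hp
  have hψo : ∀ θ > 0, ∀ᶠ x in 𝓝 y, |ψ x - ψ y - inner ℝ p (x - y)| ≤ θ * ‖x - y‖ := by
    intro θ hθ
    have h1 := hψ.hasFDerivAt.isLittleO.def hθ
    filter_upwards [h1] with x hx
    simpa [hp, gradient] using hx
  obtain ⟨κ, hκ, hκle⟩ := Metric.eventually_nhds_iff_ball.1 (hψo (η / 2) (by positivity))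
  obtain ⟨ρ, hρ0, hρr, hρκ, hρb⟩ : ∃ ρ : ℝ, 0 < ρ ∧ ρ < r ∧ ρ < κ ∧ ρ < rbar := by
    refine ⟨min (min (r / 2) (κ / 2)) (rbar / 2), by positivity, ?_, ?_, ?_⟩
    · exact ((min_le_left _ _).trans (min_le_left _ _)).trans_lt (by linarith)
    · exact ((min_le_left _ _).trans (min_le_right _ _)).trans_lt (by linarith)
    · exact (min_le_right _ _).trans_lt (by linarith)
  -- Subtracting the tangent plane of ψ costs at most half of the cone height ηρ on the sphere; the
  -- other half is carried into the ball.
  have hball := hsuper (-p) (ψ y + τ + η * ρ / 2) ρ hρ0 hρb (by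
    intro x hx
    have hxn : ‖x - y‖ = ρ := mem_sphere_iff_norm.1 hx
    have hxy : x ≠ y := by
      rintro rfl
      simp at hxn
      linarith
    have h1 := cone x ⟨mem_closedBall_iff_norm.2 (by linarith), hxy⟩
    have h2 := (abs_le.1 (hκle x (mem_ball_iff_norm.2 (by linarith)))).1
    rw [inner_neg_left]
    rw [hxn] at h1 h2
    linarith)
  obtain ⟨κ', hκ', hκ'le⟩ := Metric.eventually_nhds_iff_ball.1 (hψo (η / 4) (by positivity))
  set κ₀ : ℝ := min κ' ρ with hκ₀
  have hκ₀0 : 0 < κ₀ := lt_min hκ' hρ0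
  refine ⟨η * κ₀ / 4, by positivity, fun x hx => ?_⟩
  rcases lt_or_ge ‖x - y‖ κ₀ with hlt | hge
  · have hxρ : ‖x - y‖ < ρ := hlt.trans_le (min_le_right _ _)
    have h1 := hball x ⟨mem_ball_iff_norm.2 hxρ, hx.2⟩
    have h2 := (abs_le.1 (hκ'le x
      (mem_ball_iff_norm.2 (hlt.trans_le (min_le_left _ _))))).2
    have h3 : κ₀ ≤ ρ := min_le_right _ _
    rw [inner_neg_left] at h1
    nlinarith
  · have := cone x hx
    nlinarith

section elliptic
variable {n : ℕ} {ε : ℝ} {F : ℝ → ℝ → E n → SymMat n → ℝ}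

set_option maxHeartbeats 1000000 in
/-- The strong maximum principle at an isolated singularity: a supersolution `v` on a punctured
neighbourhood of `y` that stays above its affine minorants stays uniformly above a solution `u`,
if it is above it away from a ray. -/
theorem exists_add_le_of_singular (hF : ContDiffOn ℝ 1 (uncurry4 F) (dom n ε))
    (hell : ∀ r s : ℝ, 0 < r → r < 1 + ε → ∀ (p : E n) (M : SymMat n), (-gradM F r s p M).PosDef)
    {u v : E n → ℝ} {y e : E n} (he : ‖e‖ = 1) (hy : ‖y‖ ∈ Ioo 0 (1 + ε))
    (hu : ContDiffAt ℝ 2 u y)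
    (hv : ∀ᶠ x in 𝓝[≠] y, ContDiffAt ℝ 2 v x ∧ uncurry4 F (jet u x) ≤ uncurry4 F (jet v x) ∧
      u x ≤ v x ∧ (v x = u x → ∃ t : ℝ, 0 < t ∧ x = y - t • e))
    {rbar : ℝ} (hrbar : 0 < rbar)
    (hsuper : ∀ (V : E n) (c ρ : ℝ), 0 < ρ → ρ < rbar →
      (∀ x ∈ sphere y ρ, c ≤ v x + inner ℝ V (x - y)) →
      ∀ x ∈ ball y ρ \ {y}, c ≤ v x + inner ℝ V (x - y)) :
    ∃ c > 0, ∀ᶠ x in 𝓝[≠] y, u x + c ≤ v x := by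
  have he0 : e ≠ 0 := fun h => by simp [h] at he
  have hee : inner ℝ e e = (1 : ℝ) := by rw [real_inner_self_eq_norm_sq, he, one_pow]
  obtain ⟨ρ₁, hρ₁, Q, hQ, hQd, hQm⟩ := exists_closedBall_jet_mem hu hy
  obtain ⟨ρ₂, hρ₂, hcv⟩ := Metric.eventually_nhds_iff_ball.1 (eventually_nhdsWithin_iff.1 hv)
  obtain ⟨K₀, hNT⟩ := no_touching hF hell he0 hQ hQd (C := 5) (by norm_num)
  set K : ℝ := max K₀ 1 with hK
  have hK0 : 0 < K := zero_lt_one.trans_le (le_max_right _ _)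
  obtain ⟨δ₀, hδ₀, hNT⟩ := hNT K (le_max_left _ _)
  obtain ⟨r, hr, hr1, hrρ₁, hrρ₂, hrK⟩ : ∃ r : ℝ, 0 < r ∧ r ≤ 1 ∧ r ≤ ρ₁ ∧ r < ρ₂ ∧
      K * r ≤ 1 := by
    refine ⟨min (min 1 ρ₁) (min (ρ₂ / 2) (1 / K)), by positivity, ?_, ?_, ?_, ?_⟩
    · exact (min_le_left _ _).trans (min_le_left _ _)
    · exact (min_le_left _ _).trans (min_le_right _ _)
    · exact ((min_le_right _ _).trans (min_le_left _ _)).trans_lt (by linarith)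
    · have := (min_le_right (min 1 ρ₁) (min (ρ₂ / 2) (1 / K))).trans (min_le_right _ _)
      rw [le_div_iff₀ (by positivity)] at this
      linarith
  -- The shift r/2 makes the barrier positive at y. On the sphere, where g ≥ 0 the exceptional ray
  -- is absent and v - u has a positive minimum; where g < 0 the barrier is nonpositive.
  set g : E n → ℝ := fun x => inner ℝ (x - y) e + r / 2 with hg
  set h : E n → ℝ := fun x => g x + K * g x ^ 2 with hh
  have hgc : Continuous g := by fun_prop
  have hhc : Continuous h := by fun_prop
  have hgle : ∀ x ∈ closedBall y r, -(r / 2) ≤ g x ∧ g x ≤ 3 * r / 2 := fun x hx => by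
    have h1 := (abs_inner_le_of_unit he (x - y)).trans (mem_closedBall_iff_norm.1 hx)
    have h2 := abs_le.1 h1
    simp only [hg]
    constructor <;> linarith
  have hhle : ∀ x ∈ closedBall y r, h x ≤ 4 := fun x hx => by
    obtain ⟨h1, h2⟩ := hgle x hx
    have h3 : g x ^ 2 ≤ (3 * r / 2) ^ 2 := sq_le_sq' (by linarith) h2
    have h4 : K * g x ^ 2 ≤ K * (3 * r / 2) ^ 2 := by gcongr
    simp only [hh]
    nlinarith
  have hcmp : ∀ x ∈ closedBall y r, x ≠ y → ContDiffAt ℝ 2 v x ∧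
      uncurry4 F (jet u x) ≤ uncurry4 F (jet v x) ∧
      u x ≤ v x ∧ (v x = u x → ∃ t : ℝ, 0 < t ∧ x = y - t • e) := fun x hx hne =>
    hcv x (closedBall_subset_ball hrρ₂ hx) hne
  have hcu : ∀ x ∈ closedBall y r, ContDiffAt ℝ 2 u x ∧ jet u x ∈ Q := fun x hx =>
    hQm x (closedBall_subset_closedBall hrρ₁ hx)
  have hwc : ContinuousOn (fun x => v x - u x) (closedBall y r \ {y}) := fun x hx =>
    ((hcmp x hx.1 hx.2).1.continuousAt.sub (hcu x hx.1).1.continuousAt).continuousWithinAt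
  have hsne : ∀ x ∈ sphere y r, x ≠ y := by
    rintro x hx rfl
    simp at hx
    linarith
  obtain ⟨m, hm, hmle⟩ := ((isCompact_sphere y r).inter_right
    (isClosed_le continuous_const hgc)).exists_forall_le'
    (f := fun x => v x - u x) (a := 0)
    (hwc.mono fun x hx => ⟨sphere_subset_closedBall hx.1, hsne x hx.1⟩) (fun x hx => by
      obtain ⟨-, -, h1, h2⟩ := hcmp x (sphere_subset_closedBall hx.1) (hsne x hx.1)
      refine sub_pos.2 (lt_of_le_of_ne h1 fun h3 => ?_)
      obtain ⟨t, ht, hxt⟩ := h2 h3.symm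
      have h4 : x - y = (-t) • e := by
        rw [hxt, neg_smul]
        abel
      have h5 : ‖x - y‖ = r := mem_sphere_iff_norm.1 hx.1
      rw [h4, norm_smul, he, mul_one, norm_neg, Real.norm_of_nonneg ht.le] at h5
      have h6 : 0 ≤ g x := hx.2
      simp only [hg, h4, inner_smul_left, hee] at h6
      simp at h6
      linarith)
  set δ : ℝ := min (δ₀ / 2) (m / 5) with hδ
  have hδ0 : 0 < δ := by positivity
  have hδ1 : δ < δ₀ := (min_le_left _ _).trans_lt (by linarith)
  have hδ2 : δ ≤ m / 5 := min_le_right _ _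
  set φ : E n → ℝ := fun x => v x - u x - δ * h x with hφ
  have hφc : ContinuousOn φ (closedBall y r \ {y}) := hwc.sub (hhc.continuousOn.const_mul δ)
  have hφs : ∀ x ∈ sphere y r, 0 ≤ φ x := by
    intro x hx
    have hxc := sphere_subset_closedBall hx
    rcases le_or_gt 0 (g x) with h0 | h0
    · have h1 := hmle x ⟨hx, h0⟩
      have h2 := hhle x hxc
      simp only [hφ]
      nlinarith
    · have h1 := (hcmp x hxc (hsne x hx)).2.2.1
      have h2 := (hgle x hxc).1
      have h3 : h x ≤ 0 := by
        have : h x = g x * (1 + K * g x) := by simp only [hh]; ring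
        rw [this]
        refine mul_nonpos_of_nonpos_of_nonneg h0.le ?_
        nlinarith
      simp only [hφ]
      nlinarith
  have main : ∀ x ∈ closedBall y r \ {y}, 0 ≤ φ x := by
    by_contra! hcon
    obtain ⟨x', hx', hlt'⟩ := hcon
    have hbdd : BddBelow (φ '' (closedBall y r \ {y})) := by
      refine ⟨-(4 * δ), ?_⟩
      rintro _ ⟨x, hx, rfl⟩
      have h1 := hhle x hx.1
      have h2 := (hcmp x hx.1 hx.2).2.2.1
      simp only [hφ]
      nlinarith
    set τ : ℝ := sInf (φ '' (closedBall y r \ {y})) with hτ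
    have hτle : ∀ x ∈ closedBall y r \ {y}, τ ≤ φ x := fun x hx =>
      csInf_le hbdd (mem_image_of_mem _ hx)
    have hτ0 : τ < 0 := (hτle x' hx').trans_lt hlt'
    -- η ≤ δ keeps the tilted polynomial within the bounds of `no_touching`; η r ≤ -τ/2 keeps tilted
    -- minima off the outer sphere.
    obtain ⟨η, hη, hηδ, hητ⟩ : ∃ η : ℝ, 0 < η ∧ η ≤ δ ∧ η * r ≤ -τ / 2 := by
      refine ⟨min δ (-τ / 2 / r), lt_min hδ0 (div_pos (by linarith) hr), min_le_left _ _, ?_⟩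
      rw [← le_div_iff₀ hr]
      exact min_le_right _ _
    have tilt : ∀ V : E n, ‖V‖ ≤ η → ∀ x ∈ closedBall y r \ {y},
        τ ≤ φ x - inner ℝ V (x - y) := by
      intro V hV
      by_contra! hc
      obtain ⟨x₂, hx₂, hlt₂⟩ := hc
      have hVle : ∀ x, |inner ℝ V (x - y)| ≤ η * ‖x - y‖ := fun x =>
        (abs_real_inner_le_norm V (x - y)).trans (by gcongr)
      have hx₂0 : 0 < ‖x₂ - y‖ := norm_pos_iff.2 (sub_ne_zero.2 hx₂.2)
      set φ₂ := φ x₂ - inner ℝ V (x₂ - y) with hφ₂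
      -- At distance κ from y a tilt changes φ by less than τ - φ₂, so the tilted function exceeds
      -- φ₂ on that inner sphere and the minimum over the annulus is interior.
      set κ : ℝ := min ‖x₂ - y‖ ((τ - φ₂) / (2 * η)) with hκ
      have hκ0 : 0 < κ := lt_min hx₂0 (div_pos (by linarith) (by positivity))
      have hκη : η * κ < τ - φ₂ := by
        have h1 : κ ≤ (τ - φ₂) / (2 * η) := min_le_right _ _
        rw [le_div_iff₀ (by positivity)] at h1
        nlinarith
      set A : Set (E n) := closedBall y r ∩ {x | κ ≤ ‖x - y‖} with hA
      have hAc : IsCompact A := (isCompact_closedBall _ _).inter_right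
        (isClosed_le continuous_const (by fun_prop))
      have hAsub : A ⊆ closedBall y r \ {y} := by
        rintro x ⟨h1, h2⟩
        refine ⟨h1, ?_⟩
        rintro rfl
        simp at h2
        linarith
      have hκle : κ ≤ ‖x₂ - y‖ := min_le_left _ _
      have hx₂A : x₂ ∈ A := ⟨hx₂.1, hκle⟩
      obtain ⟨x₁, hx₁, hmin⟩ := hAc.exists_isMinOn ⟨x₂, hx₂A⟩
        (f := fun x => φ x - inner ℝ V (x - y)) ((hφc.mono hAsub).sub (by fun_prop))
      have hle₁ : φ x₁ - inner ℝ V (x₁ - y) ≤ φ₂ := hmin hx₂A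
      have hx₁P := hAsub hx₁
      have hVx₁ := abs_le.1 (hVle x₁)
      have hx₁κ : κ < ‖x₁ - y‖ := by
        refine lt_of_le_of_ne hx₁.2 fun h1 => ?_
        have h2 := hτle x₁ hx₁P
        rw [← h1] at hVx₁
        linarith
      have hx₁n : ‖x₁ - y‖ ≤ r := mem_closedBall_iff_norm.1 hx₁.1
      have hx₁r : ‖x₁ - y‖ < r := by
        refine lt_of_le_of_ne hx₁n fun h1 => ?_
        have h2 := hφs x₁ (mem_sphere_iff_norm.2 h1)
        rw [h1] at hVx₁
        linarith
      have hnhds : A ∈ 𝓝 x₁ := by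
        have hc : Continuous fun x : E n => ‖x - y‖ := by fun_prop
        filter_upwards [hc.continuousAt.eventually (lt_mem_nhds hx₁κ),
          hc.continuousAt.eventually (gt_mem_nhds hx₁r)] with x h1 h2
        exact ⟨mem_closedBall_iff_norm.2 h2.le, h1.le⟩
      set b : E n := (1 + 2 * K * g x₁) • e + δ⁻¹ • V with hb
      have hexp : ∀ x, δ * h x + inner ℝ V (x - y) =
          δ * h x₁ + inner ℝ V (x₁ - y) + δ * qpoly b e K 0 x₁ x := by
        intro x
        have h1 : x - y = (x - x₁) + (x₁ - y) := by abel
        have h2 : δ * (δ⁻¹ * inner ℝ V (x - x₁)) = inner ℝ V (x - x₁) := by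
          rw [← mul_assoc, mul_inv_cancel₀ hδ0.ne', one_mul]
        simp only [hh, hg, qpoly, hb, h1, inner_add_left, inner_add_right, inner_smul_left,
          RCLike.conj_to_real, real_inner_comm (x - x₁) e]
        linear_combination -h2
      obtain ⟨hv₁, hF₁, huv₁, -⟩ := hcmp x₁ hx₁P.1 hx₁P.2
      obtain ⟨hg₁, hg₂⟩ := hgle x₁ hx₁.1
      have hh₁ := hhle x₁ hx₁.1
      refine hNT u v x₁ b ((v x₁ - u x₁) / δ) 0 δ (hcu x₁ hx₁.1).1 hv₁
        (hcu x₁ hx₁.1).2 hF₁ ?_ ?_ ?_ hδ0 hδ1 ?_ ?_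
      · rw [abs_of_nonneg (div_nonneg (sub_nonneg.2 huv₁) hδ0.le), div_le_iff₀ hδ0]
        simp only [hφ] at hle₁
        have h1 : η * ‖x₁ - y‖ ≤ δ * 1 := by gcongr; linarith
        nlinarith
      · have h1 : ‖b‖ ≤ |1 + 2 * K * g x₁| + δ⁻¹ * ‖V‖ := by
          refine (norm_add_le _ _).trans ?_
          rw [norm_smul, norm_smul, he, mul_one, Real.norm_eq_abs, Real.norm_of_nonneg
            (inv_nonneg.2 hδ0.le)]
        have h2 : δ⁻¹ * ‖V‖ ≤ 1 := by
          rw [inv_mul_eq_div, div_le_iff₀ hδ0]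
          linarith
        have h3 : |1 + 2 * K * g x₁| ≤ 4 := by
          have h4 : K * g x₁ ≤ K * (3 * r / 2) := by gcongr
          have h5 : K * -(r / 2) ≤ K * g x₁ := by gcongr
          rw [abs_le]
          constructor <;> linarith
        linarith
      · simp
      · field_simp
        ring
      · filter_upwards [hnhds] with x hx
        have h1 : φ x₁ - inner ℝ V (x₁ - y) ≤ φ x - inner ℝ V (x - y) := hmin hx
        simp only [hφ] at h1
        have h2 : qpoly b e K 0 x₁ x₁ = 0 := by simp [qpoly]
        rw [h2]
        linarith [hexp x]
    -- At each x the tilt is chosen of length η along x - y.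
    have cone : ∀ x ∈ closedBall y r \ {y}, τ + η * ‖x - y‖ ≤ φ x := by
      intro x hx
      have hx0 : 0 < ‖x - y‖ := norm_pos_iff.2 (sub_ne_zero.2 hx.2)
      have h1 := tilt ((η / ‖x - y‖) • (x - y)) (by
        rw [norm_smul, Real.norm_of_nonneg (by positivity)]
        field_simp
        exact le_rfl) x hx
      rw [inner_smul_left, real_inner_self_eq_norm_sq] at h1
      have h2 : (starRingEnd ℝ) (η / ‖x - y‖) * ‖x - y‖ ^ 2 = η * ‖x - y‖ := by
        simp only [RCLike.conj_to_real]
        field_simp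
      linarith
    set ψ : E n → ℝ := fun x => u x + δ * h x with hψ
    have hhd : Differentiable ℝ h := by
      have hgd : Differentiable ℝ g := by
        have : g = fun x => (innerSL ℝ e) (x - y) + r / 2 := by
          funext x
          simp [hg, real_inner_comm]
        rw [this]
        fun_prop
      fun_prop
    have hψd : DifferentiableAt ℝ ψ y :=
      (hu.differentiableAt (by norm_num)).add ((hhd y).const_mul δ)
    obtain ⟨θ, hθ, hlow⟩ := exists_add_le_of_cone (τ := τ) hr hη hrbar hsuper hψd fun x hx => by
      have := cone x hx
      simp only [hφ] at this
      simp only [hψ]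
      linarith
    have : τ + θ ≤ τ := by
      refine le_csInf ⟨_, mem_image_of_mem _ hx'⟩ ?_
      rintro _ ⟨x, hx, rfl⟩
      have := hlow x hx
      simp only [hψ] at this
      simp only [hφ]
      linarith
    linarith
  refine ⟨δ * (r / 4), by positivity, ?_⟩
  have hgy : r / 4 < g y := by
    simp only [hg, sub_self, inner_zero_left]
    linarith
  rw [eventually_nhdsWithin_iff]
  filter_upwards [hgc.continuousAt.eventually (lt_mem_nhds hgy), closedBall_mem_nhds y hr]
    with x h1 h2 h3
  have h4 := main x ⟨h2, h3⟩
  have h5 : r / 4 ≤ h x := by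
    have : 0 ≤ K * g x ^ 2 := by positivity
    simp only [hh]
    linarith
  simp only [hφ] at h4
  nlinarith

end elliptic

/-! ### Strict comparison of a solution with its reflection -/

/-- A positive solution of an elliptic, rotation invariant equation in the punctured ball that
vanishes on the boundary and stays above its affine minorants near the origin. -/
structure IsSolution {n : ℕ} (ε : ℝ) (F : ℝ → ℝ → E n → SymMat n → ℝ) (u : E n → ℝ) : Prop where
  eps_pos : 0 < ε
  contDiffOn_op : ContDiffOn ℝ 1 (uncurry4 F) (dom n ε)
  elliptic : ∀ r s : ℝ, 0 < r → r < 1 + ε → ∀ (p : E n) (M : SymMat n),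
    (-gradM F r s p M).PosDef
  mono : ∀ r s : ℝ, 0 < r → r < 1 + ε → 0 < s → ∀ (p : E n) (M : SymMat n),
    0 ≤ deriv (fun ρ => F ρ s p M) r
  inv : ∀ r s : ℝ, 0 < r → r < 1 + ε → 0 < s → ∀ (p : E n) (M : SymMat n)
    (O : Matrix (Fin n) (Fin n) ℝ), O ∈ Matrix.orthogonalGroup (Fin n) ℝ →
    F r s (act O.transpose p) (conj O M) = F r s p M
  contDiffOn : ContDiffOn ℝ 2 u (closedBall 0 1 \ {0})
  super : ∃ rbar : ℝ, 0 < rbar ∧ SuperaffineNearZero u rbar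
  eq_zero : ∀ x ∈ ball (0 : E n) 1 \ {0}, uncurry4 F (jet u x) = 0
  pos : ∀ x ∈ ball (0 : E n) 1 \ {0}, 0 < u x
  boundary : ∀ x ∈ sphere (0 : E n) 1, u x = 0

/-- The moving plane inequality: `u` is at most its reflection in `⟨x, e⟩ = l` beyond that
hyperplane. -/
def ReflLE {n : ℕ} (u : E n → ℝ) (e : E n) (l : ℝ) : Prop :=
  ∀ x : E n, ‖x‖ < 1 → l < inner ℝ x e → x ≠ (2 * l) • e → u x ≤ u (refl e l x)

namespace IsSolution
variable {n : ℕ} {ε : ℝ} {F : ℝ → ℝ → E n → SymMat n → ℝ} {u : E n → ℝ}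

theorem contDiffAt (H : IsSolution ε F u) {x : E n} (hx : ‖x‖ < 1) (h0 : x ≠ 0) :
    ContDiffAt ℝ 2 u x := by
  refine H.contDiffOn.contDiffAt ?_
  filter_upwards [isOpen_ball.mem_nhds (mem_ball_zero_iff.2 hx), isOpen_ne.mem_nhds h0] with y h1 h2
  exact ⟨ball_subset_closedBall h1, h2⟩

theorem pos' (H : IsSolution ε F u) {x : E n} (hx : ‖x‖ < 1) (h0 : x ≠ 0) : 0 < u x :=
  H.pos x ⟨mem_ball_zero_iff.2 hx, h0⟩

theorem nonneg (H : IsSolution ε F u) {x : E n} (hx : ‖x‖ ≤ 1) (h0 : x ≠ 0) : 0 ≤ u x := by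
  rcases hx.lt_or_eq with h | h
  · exact (H.pos' h h0).le
  · exact (H.boundary x (mem_sphere_zero_iff_norm.2 h)).ge

/-- Near the origin the bound is the case V = 0 of the affine condition, which compares u with its
positive minimum on a small sphere; elsewhere it is compactness. -/
theorem exists_le (H : IsSolution ε F u) {ρ : ℝ} (hρ : ρ < 1) :
    ∃ c > 0, ∀ x : E n, ‖x‖ ≤ ρ → x ≠ 0 → c ≤ u x := by
  obtain ⟨rbar, hrbar, hs⟩ := H.super
  set r : ℝ := min (rbar / 2) (1 / 2) with hr
  have hr0 : 0 < r := by positivity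
  have hr1 : r < 1 := (min_le_right _ _).trans_lt (by norm_num)
  obtain ⟨m, hm1, hm2⟩ := hs 0 r hr0 ((min_le_left _ _).trans_lt (by linarith))
  simp only [inner_zero_left, add_zero] at hm1 hm2
  obtain ⟨x₀, hx₀, hx₀m⟩ := hm2.1
  have hx₀n : ‖x₀‖ = r := mem_sphere_zero_iff_norm.1 hx₀
  have hm0 : 0 < m := by
    rw [← hx₀m]
    exact H.pos' (by rw [hx₀n]; exact hr1) (norm_pos_iff.1 (by rw [hx₀n]; exact hr0))
  have hsub : closedBall (0 : E n) ρ ∩ {x | r ≤ ‖x‖} ⊆ closedBall 0 1 \ {0} := fun x hx =>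
    ⟨closedBall_subset_closedBall hρ.le hx.1, norm_pos_iff.1 (hr0.trans_le hx.2)⟩
  obtain ⟨c, hc, hcle⟩ := ((isCompact_closedBall (0 : E n) ρ).inter_right
    (isClosed_le continuous_const continuous_norm)).exists_forall_le' (f := u) (a := 0)
    (H.contDiffOn.continuousOn.mono hsub) (fun x hx =>
      H.pos' ((mem_closedBall_zero_iff.1 hx.1).trans_lt hρ) (hsub hx).2)
  refine ⟨min m c, lt_min hm0 hc, fun x hx h0 => ?_⟩
  rcases lt_or_ge ‖x‖ r with h | h
  · exact (min_le_left _ _).trans (hm1.1 (mem_image_of_mem _ ⟨mem_ball_zero_iff.2 h, h0⟩))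
  · exact (min_le_right _ _).trans (hcle x ⟨mem_closedBall_zero_iff.2 hx, h⟩)

variable {e : E n} (he : ‖e‖ = 1)
include he

theorem inner_lt_one {x : E n} (hx : ‖x‖ < 1) : inner ℝ x e < 1 :=
  ((abs_le.1 (abs_inner_le_of_unit he x)).2).trans_lt hx

theorem jet_le_jet_refl (H : IsSolution ε F u) {l : ℝ} (hl : 0 < l) {x : E n} (hx : ‖x‖ < 1)
    (hlx : l ≤ inner ℝ x e) (hne : x ≠ (2 * l) • e) :
    ContDiffAt ℝ 2 u (refl e l x) ∧ 0 < u (refl e l x) ∧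
      uncurry4 F (jet u x) ≤ uncurry4 F (jet (fun y => u (refl e l y)) x) := by
  have h1 : refl e l x ≠ 0 := fun h => hne ((refl_eq_zero_iff he).1 h)
  have h2 := norm_refl_le he hl.le hlx
  have h3 := h2.trans_lt hx
  have h0 : x ≠ 0 := by
    rintro rfl
    rw [inner_zero_left] at hlx
    linarith
  refine ⟨H.contDiffAt h3 h1, H.pos' h3 h1, ?_⟩
  rw [H.eq_zero x ⟨mem_ball_zero_iff.2 hx, h0⟩]
  exact jet_comp_refl_nonneg he H.eps_pos H.contDiffOn_op H.elliptic H.mono H.inv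
    (H.contDiffAt h3 h1) (H.pos' h3 h1) (H.eq_zero _ ⟨mem_ball_zero_iff.2 h3, h1⟩) h1 h2 hx

omit he in
theorem eventually_mem {l : ℝ} {x : E n} (hx : ‖x‖ < 1)
    (hlx : l < inner ℝ x e) (hne : x ≠ (2 * l) • e) :
    ∀ᶠ y in 𝓝 x, ‖y‖ < 1 ∧ l < inner ℝ y e ∧ y ≠ (2 * l) • e := by
  have h1 : Continuous fun y : E n => inner ℝ y e := by fun_prop
  filter_upwards [continuous_norm.continuousAt.eventually (gt_mem_nhds hx),
    h1.continuousAt.eventually (lt_mem_nhds hlx), isOpen_ne.mem_nhds hne] with y h1 h2 h3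
  exact ⟨h1, h2, h3⟩

theorem eventually_eq_refl (H : IsSolution ε F u) {l : ℝ} (hl : 0 < l) (hP : ReflLE u e l)
    {x : E n} (hx : ‖x‖ < 1) (hlx : l < inner ℝ x e) (hne : x ≠ (2 * l) • e)
    (heq : u (refl e l x) = u x) : ∀ᶠ y in 𝓝 x, u (refl e l y) = u y := by
  refine eventually_eq_of_touch (v := fun y => u (refl e l y)) H.contDiffOn_op H.elliptic ?_ heq
  filter_upwards [eventually_mem hx hlx hne] with y ⟨h1, h2, h3⟩
  obtain ⟨h4, -, h5⟩ := H.jet_le_jet_refl he hl h1 h2.le h3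
  have h0 : y ≠ 0 := by
    rintro rfl
    rw [inner_zero_left] at h2
    linarith
  exact ⟨⟨norm_pos_iff.2 h0, by linarith [H.eps_pos]⟩, H.contDiffAt h1 h0,
    contDiffAt_comp_refl h4, h5, hP y h1 h2 h3⟩

/-- The coincidence set along the segment is open by the strong maximum principle and closed by
continuity. The endpoint is excluded because in use it is a boundary point or the singular point,
where the contradiction is found. -/
theorem eq_refl_on_segment (H : IsSolution ε F u) {l : ℝ} (hl : 0 < l) (hP : ReflLE u e l)
    {x p : E n}
    (hseg : ∀ t ∈ Ico (0 : ℝ) 1, ‖x + t • (p - x)‖ < 1 ∧ l < inner ℝ (x + t • (p - x)) e ∧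
      x + t • (p - x) ≠ (2 * l) • e)
    (heq : u (refl e l x) = u x) :
    ∀ t ∈ Ico (0 : ℝ) 1, u (refl e l (x + t • (p - x))) = u (x + t • (p - x)) := by
  set γ : ℝ → E n := fun t => x + t • (p - x) with hγ
  have hγc : Continuous γ := by fun_prop
  set U : Set ℝ := {t | ∀ᶠ s in 𝓝 t, u (refl e l (γ s)) = u (γ s)} with hU
  have hloc : ∀ t ∈ Ico (0 : ℝ) 1, u (refl e l (γ t)) = u (γ t) → t ∈ U := fun t ht h =>
    hγc.continuousAt.eventually
      (H.eventually_eq_refl he hl hP (hseg t ht).1 (hseg t ht).2.1 (hseg t ht).2.2 h)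
  have hsub : Ico (0 : ℝ) 1 ⊆ U := by
    refine isPreconnected_Ico.subset_of_closure_inter_subset isOpen_setOfPred_eventually_nhds
      ⟨0, ⟨le_rfl, one_pos⟩, hloc 0 ⟨le_rfl, one_pos⟩ (by simpa [hγ] using heq)⟩ ?_
    rintro t ⟨htU, ht⟩
    refine hloc t ht ?_
    obtain ⟨h1, h2, h3⟩ := hseg t ht
    obtain ⟨h4, -, -⟩ := H.jet_le_jet_refl he hl h1 h2.le h3
    have h0 : γ t ≠ 0 := by
      intro h
      simp only [hγ] at h
      rw [h, inner_zero_left] at h2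
      linarith
    have hc1 : ContinuousAt (fun s => u (refl e l (γ s))) t :=
      ContinuousAt.comp (f := fun s => refl e l (γ s)) h4.continuousAt
        ((continuous_refl e l).comp hγc).continuousAt
    have hc2 : ContinuousAt (fun s => u (γ s)) t :=
      ContinuousAt.comp (f := γ) (H.contDiffAt h1 h0).continuousAt hγc.continuousAt
    have hfr : ∃ᶠ s in 𝓝 t, u (refl e l (γ s)) - u (γ s) = 0 :=
      (mem_closure_iff_frequently.1 htU).mono fun s hs => by
        have h5 : ∀ᶠ s in 𝓝 s, u (refl e l (γ s)) = u (γ s) := hs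
        exact sub_eq_zero.2 h5.self_of_nhds
    have hmem := (isClosed_singleton (x := (0 : ℝ))).mem_of_frequently_of_tendsto
      (hfr.mono fun s hs => mem_singleton_iff.2 hs) (hc1.sub hc2)
    exact sub_eq_zero.1 hmem
  exact fun t ht => (hsub ht).self_of_nhds

/-- Equality at x would propagate along the segment towards e, where u tends to 0 while the
reflected values stay bounded below. The segment can meet 2le only from the ray behind it, and only
if l < 1/2, since otherwise 2le is not in the open ball. This form also covers n = 1, where removing
2le disconnects the cap. -/
theorem lt_refl_off_ray (H : IsSolution ε F u) {l : ℝ} (hl : 0 < l) (hl1 : l < 1)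
    (hP : ReflLE u e l) {x : E n} (hx : ‖x‖ < 1) (hlx : l < inner ℝ x e) (hne : x ≠ (2 * l) • e)
    (hray : l < 1 / 2 → ∀ t : ℝ, 0 < t → x ≠ (2 * l) • e - t • e) : u x < u (refl e l x) := by
  refine lt_of_le_of_ne (hP x hx hlx hne) fun heq => ?_
  have hseg : ∀ t ∈ Ico (0 : ℝ) 1, ‖x + t • (e - x)‖ < 1 ∧ l < inner ℝ (x + t • (e - x)) e ∧
      x + t • (e - x) ≠ (2 * l) • e := by
    intro t ht
    have ht1 : 0 < 1 - t := by linarith [ht.2]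
    have h1 : x + t • (e - x) = (1 - t) • x + t • e := by
      rw [smul_sub, sub_smul, one_smul]
      abel
    have h2 : ‖x + t • (e - x)‖ < 1 := by
      rw [h1]
      refine (norm_add_le _ _).trans_lt ?_
      rw [norm_smul, norm_smul, he, Real.norm_of_nonneg ht1.le, Real.norm_of_nonneg ht.1]
      nlinarith
    have h3 : inner ℝ (x + t • (e - x)) e = (1 - t) * inner ℝ x e + t := by
      rw [h1, inner_add_left, inner_smul_left, inner_smul_left, inner_self_of_unit he]
      simp
    refine ⟨h2, ?_, fun h => ?_⟩
    · rw [h3]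
      nlinarith [ht.1]
    · have h4 := inner_lt_one he h2
      have h5 : inner ℝ (x + t • (e - x)) e = 2 * l := by
        rw [h, inner_smul_left, inner_self_of_unit he]
        simp
      have h6 : x = (2 * l) • e - (t * (1 - 2 * l) / (1 - t)) • e := by
        rw [h1] at h
        have h7 : (1 - t) • x = (2 * l - t) • e := by
          rw [sub_smul (2 * l) t e, ← h]
          abel
        have h8 : x = (1 - t)⁻¹ • (2 * l - t) • e := by
          rw [← h7, smul_smul, inv_mul_cancel₀ ht1.ne', one_smul]
        rw [h8, smul_smul, ← sub_smul]
        congr 1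
        field_simp
        ring
      rcases ht.1.eq_or_lt with h9 | h9
      · rw [← h9] at h6
        simp at h6
        exact hne h6
      · refine hray (by linarith) _ ?_ h6
        have : 0 < 1 - 2 * l := by linarith
        positivity
  have heqs := H.eq_refl_on_segment he hl hP hseg heq.symm
  have hre : ‖refl e l e‖ < 1 := by
    rw [← he]
    exact norm_refl_lt he hl (by rw [inner_self_of_unit he]; exact hl1)
  obtain ⟨ρ, hρ1, hρ2⟩ := exists_between hre
  obtain ⟨c, hc, hcle⟩ := H.exists_le hρ2
  have hγc : Continuous fun t : ℝ => x + t • (e - x) := by fun_prop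
  have hγ1 : x + (1 : ℝ) • (e - x) = e := by simp
  have hlim : Tendsto (fun t : ℝ => x + t • (e - x)) (𝓝[<] 1)
      (𝓝[closedBall 0 1 \ {0}] e) := by
    refine tendsto_nhdsWithin_iff.2 ⟨?_, ?_⟩
    · have := hγc.continuousAt (x := 1)
      rw [ContinuousAt, hγ1] at this
      exact this.mono_left nhdsWithin_le_nhds
    · filter_upwards [Ioo_mem_nhdsLT (zero_lt_one (α := ℝ))] with t ht
      obtain ⟨h1, h2, -⟩ := hseg t (Ioo_subset_Ico_self ht)
      refine ⟨mem_closedBall_zero_iff.2 h1.le, ?_⟩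
      rintro h
      rw [mem_singleton_iff.1 h, inner_zero_left] at h2
      linarith
  have hemem : e ∈ closedBall (0 : E n) 1 \ {0} :=
    ⟨mem_closedBall_zero_iff.2 he.le, fun h => by
      rw [mem_singleton_iff.1 h] at he
      simp at he⟩
  have hu0 := (H.contDiffOn.continuousOn e hemem).tendsto.comp hlim
  rw [H.boundary e (mem_sphere_zero_iff_norm.2 he)] at hu0
  have hge : ∀ᶠ t : ℝ in 𝓝[<] 1, c ≤ u (x + t • (e - x)) := by
    have h1 : ∀ᶠ t : ℝ in 𝓝 1, ‖refl e l (x + t • (e - x))‖ < ρ := by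
      have h2 : Continuous fun t : ℝ => ‖refl e l (x + t • (e - x))‖ :=
        ((continuous_refl e l).comp hγc).norm
      exact h2.continuousAt.eventually (gt_mem_nhds (by simpa only [hγ1] using hρ1))
    filter_upwards [nhdsWithin_le_nhds h1, Ioo_mem_nhdsLT (zero_lt_one (α := ℝ))] with t h1 h2
    rw [← heqs t (Ioo_subset_Ico_self h2)]
    exact hcle _ h1.le fun h => (hseg t (Ioo_subset_Ico_self h2)).2.2 ((refl_eq_zero_iff he).1 h)
  have := ge_of_tendsto hu0 hge
  linarith

theorem exists_add_le_refl (H : IsSolution ε F u) {l : ℝ} (hl : 0 < l) (hl1 : l < 1 / 2)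
    (hP : ReflLE u e l) :
    ∃ c > 0, ∀ᶠ x in 𝓝[≠] ((2 * l) • e), u x + c ≤ u (refl e l x) := by
  obtain ⟨rbar, hrbar, hs⟩ := H.super
  have hyn : ‖(2 * l) • e‖ = 2 * l := by
    rw [norm_smul, he, mul_one, Real.norm_of_nonneg (by linarith)]
  have hyi : inner ℝ ((2 * l) • e) e = 2 * l := by
    rw [inner_smul_left, inner_self_of_unit he]
    simp
  refine exists_add_le_of_singular (v := fun y => u (refl e l y)) H.contDiffOn_op H.elliptic he
    ⟨by rw [hyn]; linarith, by rw [hyn]; linarith [H.eps_pos]⟩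
    (H.contDiffAt (by rw [hyn]; linarith) (norm_pos_iff.1 (by rw [hyn]; linarith))) ?_ hrbar ?_
  · rw [eventually_nhdsWithin_iff]
    have h1 : Continuous fun y : E n => inner ℝ y e := by fun_prop
    filter_upwards [continuous_norm.continuousAt.eventually
        (gt_mem_nhds (show ‖(2 * l) • e‖ < 1 by rw [hyn]; linarith)),
      h1.continuousAt.eventually
        (lt_mem_nhds (show l < inner ℝ ((2 * l) • e) e by rw [hyi]; linarith))] with x h1 h2 h3
    obtain ⟨h4, -, h5⟩ := H.jet_le_jet_refl he hl h1 h2.le h3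
    refine ⟨contDiffAt_comp_refl h4, h5, hP x h1 h2 h3, fun h6 => ?_⟩
    by_contra! hc
    exact (H.lt_refl_off_ray he hl (by linarith) hP h1 h2 h3 fun _ => hc).ne h6.symm
  · intro V c ρ hρ hρr hsph x hx
    -- The reflection carries balls about 0 to balls about 2le and the slope `reflL e V` to V, so
    -- the affine condition is transported to the reflected function.
    obtain ⟨m, hm1, hm2⟩ := hs (reflL e V) ρ hρ hρr
    have hz : ∀ z : E n, inner ℝ (reflL e V) z = inner ℝ V (refl e l z - (2 * l) • e) := by
      intro z
      rw [inner_reflL, refl_eq, add_sub_cancel_right]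
    have hnorm : ∀ z : E n, ‖refl e l z - (2 * l) • e‖ = ‖z‖ := by
      intro z
      rw [refl_eq, add_sub_cancel_right, norm_reflL he]
    have hcm : c ≤ m := by
      obtain ⟨z, hz1, hz2⟩ := hm2.1
      have h1 := hsph (refl e l z) (by
        rw [mem_sphere_iff_norm, hnorm]
        exact mem_sphere_zero_iff_norm.1 hz1)
      simp only [refl_refl he] at h1
      simp only [hz] at hz2
      linarith
    refine hcm.trans (hm1.1 ⟨refl e l x, ⟨?_, ?_⟩, ?_⟩)
    · rw [mem_ball_zero_iff, ← hnorm, refl_refl he]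
      exact mem_ball_iff_norm.1 hx.1
    · exact fun h => hx.2 ((refl_eq_zero_iff he).1 h)
    · simp only [hz, refl_refl he]

/-- For a point on the exceptional ray, equality is propagated towards 2le instead, where the
uniform gap of `exists_add_le_refl` contradicts it. -/
theorem lt_refl (H : IsSolution ε F u) {l : ℝ} (hl : 0 < l) (hl1 : l < 1)
    (hP : ReflLE u e l) {x : E n} (hx : ‖x‖ < 1) (hlx : l < inner ℝ x e)
    (hne : x ≠ (2 * l) • e) : u x < u (refl e l x) := by
  by_contra! hcon
  have heq : u (refl e l x) = u x := le_antisymm hcon (hP x hx hlx hne)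
  obtain ⟨hl2, t, ht, hxt⟩ : l < 1 / 2 ∧ ∃ t : ℝ, 0 < t ∧ x = (2 * l) • e - t • e := by
    by_contra! hc
    exact (H.lt_refl_off_ray he hl hl1 hP hx hlx hne hc).ne heq.symm
  set y := (2 * l) • e with hy
  have hyx : y - x = t • e := by
    rw [hxt]
    abel
  have hxi : inner ℝ x e = 2 * l - t := by
    rw [hxt, hy, ← sub_smul, inner_smul_left, inner_self_of_unit he]
    simp
  have hγ : ∀ s : ℝ, x + s • (y - x) = (2 * l - t + s * t) • e := by
    intro s
    rw [hyx, hxt, hy, smul_smul, ← sub_smul, ← add_smul]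
  have he0 : e ≠ 0 := fun h => by simp [h] at he
  have hseg : ∀ s ∈ Ico (0 : ℝ) 1, ‖x + s • (y - x)‖ < 1 ∧ l < inner ℝ (x + s • (y - x)) e ∧
      x + s • (y - x) ≠ (2 * l) • e := by
    intro s hs
    have h1 : 0 ≤ s * t := mul_nonneg hs.1 ht.le
    have h2 : s * t < t := by nlinarith [hs.2]
    rw [hxi] at hlx
    rw [hγ, norm_smul, he, inner_smul_left, inner_self_of_unit he, mul_one, mul_one,
      Real.norm_of_nonneg (by linarith)]
    simp only [RCLike.conj_to_real]
    refine ⟨by linarith, by linarith, fun h => ?_⟩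
    have := smul_left_injective ℝ he0 h
    linarith
  have heqs := H.eq_refl_on_segment he hl hP hseg heq
  obtain ⟨c, hc, hev⟩ := H.exists_add_le_refl he hl hl2 hP
  have hlim : Tendsto (fun s : ℝ => x + s • (y - x)) (𝓝[<] 1) (𝓝[≠] y) := by
    refine tendsto_nhdsWithin_iff.2 ⟨?_, ?_⟩
    · have h1 : Continuous fun s : ℝ => x + s • (y - x) := by fun_prop
      have := h1.continuousAt (x := 1)
      rw [ContinuousAt, one_smul, add_sub_cancel] at this
      exact this.mono_left nhdsWithin_le_nhds
    · filter_upwards [Ioo_mem_nhdsLT (zero_lt_one (α := ℝ))] with s hs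
      exact (hseg s (Ioo_subset_Ico_self hs)).2.2
  obtain ⟨s, hs1, hs2⟩ := ((hlim.eventually hev).and
    (Ioo_mem_nhdsLT (zero_lt_one (α := ℝ)))).exists
  have := heqs s (Ioo_subset_Ico_self hs2)
  linarith

end IsSolution

/-! ### Moving the plane -/

namespace IsSolution
variable {n : ℕ} {ε : ℝ} {F : ℝ → ℝ → E n → SymMat n → ℝ} {u : E n → ℝ} {e : E n} (he : ‖e‖ = 1)
include he

/-- The gap at 2le, read at the origin, where it can be used for neighbouring planes as well. For l
= 1/2 the point 2le lies on the unit sphere, and positivity of u near 0 is enough. -/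
theorem exists_add_le_near_zero (H : IsSolution ε F u) {l : ℝ} (hl : 0 < l) (hl1 : l ≤ 1 / 2)
    (hP : ReflLE u e l) : ∃ c > 0, ∀ᶠ z in 𝓝[≠] (0 : E n), u ((2 * l) • e) + c ≤ u z := by
  have hyn : ‖(2 * l) • e‖ = 2 * l := by
    rw [norm_smul, he, mul_one, Real.norm_of_nonneg (by linarith)]
  rcases hl1.lt_or_eq with hlt | heq
  · obtain ⟨c, hc, hev⟩ := H.exists_add_le_refl he hl hlt hP
    have hlim : Tendsto (refl e l) (𝓝[≠] 0) (𝓝[≠] ((2 * l) • e)) := by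
      refine tendsto_nhdsWithin_iff.2 ⟨?_, ?_⟩
      · have := (continuous_refl e l).continuousAt (x := 0)
        rw [ContinuousAt, refl_zero] at this
        exact this.mono_left nhdsWithin_le_nhds
      · filter_upwards [self_mem_nhdsWithin] with z hz h
        rw [mem_singleton_iff, ← refl_eq_zero_iff he, refl_refl he] at h
        exact hz h
    have hcont : ContinuousAt u ((2 * l) • e) :=
      (H.contDiffAt (by rw [hyn]; linarith) (norm_pos_iff.1 (by rw [hyn]; linarith))).continuousAt
    have hc2 : ∀ᶠ x in 𝓝[≠] ((2 * l) • e), u ((2 * l) • e) - c / 2 < u x :=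
      nhdsWithin_le_nhds (hcont.eventually (lt_mem_nhds (by linarith)))
    refine ⟨c / 2, by positivity, ?_⟩
    filter_upwards [hlim.eventually hev, hlim.eventually hc2] with z h1 h2
    rw [refl_refl he] at h1
    linarith
  · obtain ⟨c, hc, hcle⟩ := H.exists_le (ρ := 1 / 2) (by norm_num)
    refine ⟨c, hc, ?_⟩
    rw [H.boundary _ (mem_sphere_zero_iff_norm.2 (by rw [hyn, heq]; norm_num)), zero_add,
      eventually_nhdsWithin_iff]
    filter_upwards [ball_mem_nhds (0 : E n) (show (0 : ℝ) < 1 / 2 by norm_num)] with z h1 h2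
    exact hcle z (mem_ball_zero_iff.1 h1).le h2

omit he in
theorem continuous_refl_prod : Continuous fun z : ℝ × E n => refl e z.1 z.2 := by
  unfold refl
  fun_prop

/-- Away from the plane the comparison is strict, including on the unit sphere and near 2le, so by
compactness it survives a small move of the plane. -/
theorem eventually_le_refl_of_le_inner (H : IsSolution ε F u) {l : ℝ} (hl : 0 < l) (hl1 : l < 1)
    (hP : ReflLE u e l) {d : ℝ} (hd : 0 < d) :
    ∀ᶠ μ in 𝓝 l, ∀ x : E n, ‖x‖ < 1 → l + d ≤ inner ℝ x e → x ≠ (2 * μ) • e →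
      u x ≤ u (refl e μ x) := by
  have hA : IsCompact (closedBall (0 : E n) 1 ∩ {x | l + d ≤ inner ℝ x e}) :=
    (isCompact_closedBall _ _).inter_right (isClosed_le continuous_const (by fun_prop))
  have key := hA.eventually_forall_of_forall_eventually (x₀ := l)
    (P := fun μ x => ‖x‖ < 1 → x ≠ (2 * μ) • e → u x ≤ u (refl e μ x)) ?_
  · filter_upwards [key] with μ hμ x h1 h2 h3
    exact hμ x ⟨mem_closedBall_zero_iff.2 h1.le, h2⟩ h1 h3
  rintro x ⟨hx1, hxd : l + d ≤ inner ℝ x e⟩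
  rw [mem_closedBall_zero_iff] at hx1
  have hlx : l < inner ℝ x e := by linarith
  have hx0 : x ≠ 0 := by
    rintro rfl
    rw [inner_zero_left] at hlx
    linarith
  have hcx := H.contDiffOn.continuousOn x ⟨mem_closedBall_zero_iff.2 hx1, hx0⟩
  have hlow : ∀ m, u x < m → ∀ᶠ z : ℝ × E n in 𝓝 (l, x), ‖z.2‖ < 1 → u z.2 < m := by
    intro m hm
    have h1 := eventually_nhdsWithin_iff.1 (hcx.eventually (gt_mem_nhds hm))
    filter_upwards [continuous_snd.continuousAt.eventually h1,
      continuous_snd.continuousAt.eventually (isOpen_ne.mem_nhds hx0)] with z h2 h3 h4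
    exact h2 ⟨mem_closedBall_zero_iff.2 h4.le, h3⟩
  have hrc : ContinuousAt (fun z : ℝ × E n => refl e z.1 z.2) (l, x) :=
    (continuous_refl_prod).continuousAt
  by_cases hne : x = (2 * l) • e
  · have hyn : ‖(2 * l) • e‖ = 2 * l := by
      rw [norm_smul, he, mul_one, Real.norm_of_nonneg (by linarith)]
    have hl2 : l ≤ 1 / 2 := by
      rw [hne, hyn] at hx1
      linarith
    obtain ⟨c, hc, hev⟩ := H.exists_add_le_near_zero he hl hl2 hP
    rw [← hne] at hev
    have h0 : refl e l x = 0 := (refl_eq_zero_iff he).2 hne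
    rw [ContinuousAt] at hrc
    simp only [h0] at hrc
    filter_upwards [hlow (u x + c) (by linarith),
      hrc.eventually (eventually_nhdsWithin_iff.1 hev)] with z h1 h2 h3 h4
    have h5 := h2 fun h => h4 ((refl_eq_zero_iff he).1 h)
    have := h1 h3
    linarith
  · have h0 : refl e l x ≠ 0 := fun h => hne ((refl_eq_zero_iff he).1 h)
    have h1 : ‖refl e l x‖ < 1 := (norm_refl_lt he hl hlx).trans_le hx1
    have hlt : u x < u (refl e l x) := by
      rcases hx1.lt_or_eq with h | h
      · exact H.lt_refl he hl hl1 hP h hlx hne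
      · rw [H.boundary x (mem_sphere_zero_iff_norm.2 h)]
        exact H.pos' h1 h0
    obtain ⟨m, hm1, hm2⟩ := exists_between hlt
    have hcr : ContinuousAt (fun z : ℝ × E n => u (refl e z.1 z.2)) (l, x) :=
      ContinuousAt.comp (f := fun z : ℝ × E n => refl e z.1 z.2)
        (H.contDiffAt h1 h0).continuousAt hrc
    filter_upwards [hlow m hm1, hcr.eventually (lt_mem_nhds hm2)] with z h2 h3 h4 _
    exact ((h2 h4).trans h3).le

/-- The maximum principle in narrow slabs. -/
theorem reflLE_of_narrow (H : IsSolution ε F u) {a : ℝ} (ha : 0 < a) :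
    ∃ d > 0, ∀ μ : ℝ, a ≤ μ → μ < 1 →
      (∀ x : E n, ‖x‖ < 1 → μ + d ≤ inner ℝ x e → x ≠ (2 * μ) • e → u x ≤ u (refl e μ x)) →
      ReflLE u e μ := by
  have he0 : e ≠ 0 := fun h => by simp [h] at he
  have hSd : UniqueDiffOn ℝ (closedBall (0 : E n) 1 \ {0}) := by
    refine (uniqueDiffOn_convex (convex_closedBall (0 : E n) 1) ?_).inter (t := {0}ᶜ)
      isOpen_compl_singleton
    rw [interior_closedBall _ one_ne_zero]
    exact ⟨0, mem_ball_self one_pos⟩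
  have hT : ∀ {ρ : ℝ}, 0 < ρ →
      IsCompact (closedBall (0 : E n) 1 ∩ {x | ρ ≤ ‖x‖}) ∧
      closedBall (0 : E n) 1 ∩ {x | ρ ≤ ‖x‖} ⊆ closedBall 0 1 \ {0} := fun {ρ} hρ =>
    ⟨(isCompact_closedBall _ _).inter_right (isClosed_le continuous_const continuous_norm),
      fun x hx => ⟨hx.1, norm_pos_iff.1 (hρ.trans_le hx.2)⟩⟩
  obtain ⟨Q, hQ, hQd, hQm⟩ := exists_isCompact_jet_mem (ε := ε) hSd H.contDiffOn (hT ha).1 (hT ha).2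
    fun x hx => ⟨ha.trans_le hx.2, by
      have := mem_closedBall_zero_iff.1 hx.1
      linarith [H.eps_pos]⟩
  obtain ⟨K₀, hNT⟩ := no_touching H.contDiffOn_op H.elliptic he0 hQ hQd (C := 1) zero_le_one
  set K : ℝ := max K₀ 1 with hK
  have hK1 : 1 ≤ K := le_max_right _ _
  obtain ⟨δ₀, hδ₀, hNT⟩ := hNT K (le_max_left _ _)
  have huc := (hT (half_pos ha)).1.uniformContinuousOn_of_continuous
    (H.contDiffOn.continuousOn.mono (hT (half_pos ha)).2)
  obtain ⟨κ, hκ, hκu⟩ := Metric.uniformContinuousOn_iff.1 huc (δ₀ / 2) (by positivity)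
  -- d ≤ a/2 keeps the slab and its reflection away from the origin, 2d < κ brings mirror points
  -- within the modulus of continuity, and 2Kd ≤ 1 keeps g at least 1/2.
  obtain ⟨d, hd, hda, hdκ, hdK⟩ : ∃ d : ℝ, 0 < d ∧ d ≤ a / 2 ∧ 2 * d < κ ∧ 2 * K * d ≤ 1 := by
    refine ⟨min (a / 2) (min (κ / 3) (1 / (2 * K))), by positivity, min_le_left _ _, ?_, ?_⟩
    · have := (min_le_right (a / 2) (min (κ / 3) (1 / (2 * K)))).trans (min_le_left _ _)
      linarith
    · have := (min_le_right (a / 2) (min (κ / 3) (1 / (2 * K)))).trans (min_le_right _ _)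
      rw [le_div_iff₀ (by positivity)] at this
      linarith
  have hd1 : d ≤ 1 / 2 := by nlinarith
  refine ⟨d, hd, fun μ hμ hμ1 hfar x' hx'1 hx'μ hx'ne => ?_⟩
  by_contra! hlt'
  have hx'd : inner ℝ x' e < μ + d := by
    by_contra! h
    exact absurd (hfar x' hx'1 h hx'ne) (not_le.2 hlt')
  have hμ0 : 0 < μ := ha.trans_le hμ
  set s : E n → ℝ := fun x => inner ℝ x e - μ with hs
  set g : E n → ℝ := fun x => 1 - K * s x ^ 2 with hg
  have hsc : Continuous s := by fun_prop
  have hgc : Continuous g := by fun_prop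
  set A : Set (E n) := closedBall 0 1 ∩ {x | 0 ≤ s x ∧ s x ≤ d} with hA
  have hAc : IsCompact A := (isCompact_closedBall _ _).inter_right
    ((isClosed_le continuous_const hsc).inter (isClosed_le hsc continuous_const))
  have hgA : ∀ x ∈ A, 1 / 2 ≤ g x ∧ g x ≤ 1 := by
    rintro x ⟨-, h1, h2⟩
    have h3 : s x ^ 2 ≤ d ^ 2 := by gcongr
    have h4 : K * s x ^ 2 ≤ K * d ^ 2 := by gcongr
    have h5 : 0 ≤ K * s x ^ 2 := by positivity
    simp only [hg]
    constructor <;> nlinarith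
  have hAn : ∀ x ∈ A, a ≤ ‖x‖ ∧ a / 2 ≤ ‖refl e μ x‖ ∧ ‖refl e μ x‖ ≤ 1 ∧ ‖x‖ ≤ 1 := by
    rintro x ⟨hx1, h1, h2⟩
    simp only [hs] at h1 h2
    have h3 := (abs_le.1 (abs_inner_le_of_unit he x)).2
    have h4 := (abs_le.1 (abs_inner_le_of_unit he (refl e μ x))).2
    rw [inner_refl he] at h4
    have h5 := norm_refl_le he hμ0.le (x := x) (by linarith)
    have h6 := mem_closedBall_zero_iff.1 hx1
    exact ⟨by linarith, by linarith, h5.trans h6, h6⟩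
  have hAmem : ∀ x ∈ A, x ∈ closedBall (0 : E n) 1 ∩ {x | a / 2 ≤ ‖x‖} ∧
      refl e μ x ∈ closedBall (0 : E n) 1 ∩ {x | a / 2 ≤ ‖x‖} := by
    intro x hx
    obtain ⟨h1, h2, h3, h4⟩ := hAn x hx
    have h5 : a / 2 ≤ ‖x‖ := by linarith
    exact ⟨⟨mem_closedBall_zero_iff.2 h4, h5⟩, ⟨mem_closedBall_zero_iff.2 h3, h2⟩⟩
  have huT := H.contDiffOn.continuousOn.mono (hT (half_pos ha)).2
  have hwc : ContinuousOn (fun x => u (refl e μ x) - u x) A :=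
    (huT.comp (continuous_refl e μ).continuousOn fun x hx => (hAmem x hx).2).sub
      (huT.mono fun x hx => (hAmem x hx).1)
  have hx'A : x' ∈ A := by
    refine ⟨mem_closedBall_zero_iff.2 hx'1.le, ?_, ?_⟩ <;> simp only [hs] <;> linarith
  -- At a minimum of the quotient with value -τ < 0 the reflected function touches u - τg from
  -- above, and -g has convexity K along e.
  obtain ⟨x₁, hx₁, hmin⟩ := hAc.exists_isMinOn ⟨x', hx'A⟩
    (f := fun x => (u (refl e μ x) - u x) / g x)
    (hwc.div hgc.continuousOn fun x hx => by linarith [(hgA x hx).1])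
  set τ : ℝ := -((u (refl e μ x₁) - u x₁) / g x₁) with hτ
  have hτ0 : 0 < τ := by
    have h1 : (u (refl e μ x₁) - u x₁) / g x₁ ≤ (u (refl e μ x') - u x') / g x' := hmin hx'A
    have h2 : (u (refl e μ x') - u x') / g x' < 0 :=
      div_neg_of_neg_of_pos (by linarith) (by linarith [(hgA x' hx'A).1])
    linarith
  obtain ⟨hg1, hg2⟩ := hgA x₁ hx₁
  have hwτ : u (refl e μ x₁) = u x₁ + τ * -g x₁ := by
    rw [hτ]
    field_simp
    ring
  have hmin' : ∀ x ∈ A, -τ * g x ≤ u (refl e μ x) - u x := by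
    intro x hx
    have h1 : (u (refl e μ x₁) - u x₁) / g x₁ ≤ (u (refl e μ x) - u x) / g x := hmin hx
    rw [hτ, neg_neg]
    exact (le_div_iff₀ (by linarith [(hgA x hx).1])).1 h1
  have hneg : u (refl e μ x₁) < u x₁ := by
    rw [hwτ]
    nlinarith
  obtain ⟨hn1, hn2, hn3, hn4⟩ := hAn x₁ hx₁
  have hx₁0 : x₁ ≠ 0 := norm_pos_iff.1 (by linarith)
  have hr₁0 : refl e μ x₁ ≠ 0 := norm_pos_iff.1 (by linarith)
  have hx₁lt : ‖x₁‖ < 1 := by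
    refine lt_of_le_of_ne hn4 fun h => ?_
    rw [H.boundary x₁ (mem_sphere_zero_iff_norm.2 h)] at hneg
    exact absurd (H.nonneg hn3 hr₁0) (not_le.2 hneg)
  have hs₁0 : 0 < s x₁ := by
    refine lt_of_le_of_ne hx₁.2.1 fun h => ?_
    rw [refl_of_inner_eq (by simp only [hs] at h; linarith)] at hneg
    exact lt_irrefl _ hneg
  have hx₁ne : x₁ ≠ (2 * μ) • e := fun h => hr₁0 ((refl_eq_zero_iff he).2 h)
  have hs₁d : s x₁ < d := by
    refine lt_of_le_of_ne hx₁.2.2 fun h => ?_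
    have := hfar x₁ hx₁lt (by simp only [hs] at h; linarith) hx₁ne
    linarith
  -- The values of u at x₁ and its reflection differ by less than δ₀/2, and g ≥ 1/2 there.
  have hτδ : τ < δ₀ := by
    have h1 : dist x₁ (refl e μ x₁) < κ := by
      rw [dist_eq_norm, refl, sub_sub_cancel, norm_smul, he, mul_one,
        Real.norm_of_nonneg (by simp only [hs] at hs₁0; linarith)]
      simp only [hs] at hs₁d
      linarith
    have h2 := hκu x₁ (hAmem x₁ hx₁).1 (refl e μ x₁) (hAmem x₁ hx₁).2 h1
    rw [Real.dist_eq] at h2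
    have h3 := (abs_lt.1 h2).2
    nlinarith
  have hμx₁ : μ ≤ inner ℝ x₁ e := by
    simp only [hs] at hs₁0
    linarith
  obtain ⟨hv1, -, hv2⟩ := H.jet_le_jet_refl he hμ0 hx₁lt hμx₁ hx₁ne
  have hnhds : A ∈ 𝓝 x₁ := by
    filter_upwards [isOpen_ball.mem_nhds (mem_ball_zero_iff.2 hx₁lt),
      hsc.continuousAt.eventually (lt_mem_nhds hs₁0),
      hsc.continuousAt.eventually (gt_mem_nhds hs₁d)] with x h1 h2 h3
    exact ⟨ball_subset_closedBall h1, h2.le, h3.le⟩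
  refine hNT u (fun y => u (refl e μ y)) x₁ ((2 * K * s x₁) • e) (-g x₁) 0 τ
    (H.contDiffAt hx₁lt hx₁0) (contDiffAt_comp_refl hv1)
    (hQm x₁ ⟨mem_closedBall_zero_iff.2 hn4, hn1⟩ ?_) hv2 ?_ ?_ ?_ hτ0 hτδ hwτ ?_
  · refine mem_interior.2 ⟨ball 0 1 \ {0}, fun x hx => ⟨ball_subset_closedBall hx.1, hx.2⟩,
      isOpen_ball.sdiff isClosed_singleton, mem_ball_zero_iff.2 hx₁lt, hx₁0⟩
  · rw [abs_neg, abs_of_nonneg (by linarith)]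
    exact hg2
  · rw [norm_smul, he, mul_one, Real.norm_of_nonneg (by positivity)]
    nlinarith
  · simp
  · filter_upwards [hnhds] with x hx
    have h1 := hmin' x hx
    have h2 : qpoly ((2 * K * s x₁) • e) e K 0 x₁ x₁ = 0 := by simp [qpoly]
    have h3 : qpoly ((2 * K * s x₁) • e) e K 0 x₁ x = g x₁ - g x := by
      simp only [qpoly, hg, hs, inner_sub_left, inner_smul_left, inner_sub_right,
        RCLike.conj_to_real, real_inner_comm x e, real_inner_comm x₁ e]
      ring
    rw [h2, h3]
    linarith

theorem reflLE_of_forall_gt (H : IsSolution ε F u) {l : ℝ} (hl : 0 ≤ l) (hl1 : l < 1)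
    (hP : ∀ μ, l < μ → μ < 1 → ReflLE u e μ) : ReflLE u e l := by
  intro x hx hlx hne
  have h0 : refl e l x ≠ 0 := fun h => hne ((refl_eq_zero_iff he).1 h)
  have h1 : ‖refl e l x‖ < 1 := (norm_refl_le he hl hlx.le).trans_lt hx
  have hc : Continuous fun μ : ℝ => refl e μ x := by
    unfold refl
    fun_prop
  have hlim : Tendsto (fun μ => u (refl e μ x)) (𝓝[>] l) (𝓝 (u (refl e l x))) := by
    have : ContinuousAt (fun μ => u (refl e μ x)) l :=
      ContinuousAt.comp (f := fun μ : ℝ => refl e μ x) (H.contDiffAt h1 h0).continuousAt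
        hc.continuousAt
    exact this.mono_left nhdsWithin_le_nhds
  refine ge_of_tendsto hlim ?_
  filter_upwards [Ioo_mem_nhdsGT (lt_min hlx hl1),
    nhdsWithin_le_nhds (hc.continuousAt.eventually (isOpen_ne.mem_nhds h0))] with μ hμ h2
  exact hP μ hμ.1 (hμ.2.trans_le (min_le_right _ _)) x hx (hμ.2.trans_le (min_le_left _ _))
    fun h => h2 ((refl_eq_zero_iff he).2 h)

/-- The moving plane method. -/
theorem reflLE (H : IsSolution ε F u) {l : ℝ} (hl : 0 ≤ l) (hl1 : l < 1) : ReflLE u e l := by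
  suffices h : ∀ μ : ℝ, 0 < μ → μ < 1 → ReflLE u e μ from
    H.reflLE_of_forall_gt he hl hl1 fun μ h1 h2 => h μ (hl.trans_lt h1) h2
  set G : Set ℝ := {μ | 0 < μ ∧ μ < 1 ∧ ∀ ν, μ ≤ ν → ν < 1 → ReflLE u e ν} with hG
  have hGb : BddBelow G := ⟨0, fun μ hμ => hμ.1.le⟩
  obtain ⟨d₁, hd₁, hnar₁⟩ := H.reflLE_of_narrow he (show (0 : ℝ) < 1 / 2 by norm_num)
  -- Beyond 1 - d₁ the whole cap is a slab of width less than d₁, so the far part is empty.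
  have hstart : max (1 / 2) (1 - d₁) ∈ G := by
    refine ⟨lt_max_of_lt_left (by norm_num), max_lt (by norm_num) (by linarith),
      fun ν hν hν1 => hnar₁ ν ((le_max_left _ _).trans hν) hν1 fun x hx hxd _ => ?_⟩
    have h1 := inner_lt_one he hx
    have h2 := (le_max_right (1 / 2) (1 - d₁)).trans hν
    linarith
  set m := sInf G with hm
  have hm1 : m < 1 := (csInf_le hGb hstart).trans_lt hstart.2.1
  have habove : ∀ μ, m < μ → μ < 1 → ReflLE u e μ := by
    intro μ h1 h2
    obtain ⟨g, hg, hgμ⟩ := exists_lt_of_csInf_lt ⟨_, hstart⟩ h1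
    exact hg.2.2 μ hgμ.le h2
  rcases le_or_gt m 0 with hm0 | hm0
  · exact fun μ h1 h2 => habove μ (hm0.trans_lt h1) h2
  exfalso
  have hPm := H.reflLE_of_forall_gt he hm0.le hm1 habove
  obtain ⟨d, hd, hnar⟩ := H.reflLE_of_narrow he (half_pos hm0)
  have hev := H.eventually_le_refl_of_le_inner he hm0 hm1 hPm (half_pos hd)
  obtain ⟨δ, hδ, hev⟩ := Metric.eventually_nhds_iff_ball.1 hev
  -- For ν between m - η and m, the part beyond ν + d lies beyond m + d/2, where stability applies;
  -- ν ≥ m/2 makes the slab width d available.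
  set η : ℝ := min (δ / 2) (min (d / 2) (m / 2)) with hη
  have hη0 : 0 < η := by positivity
  have hη1 : η < δ := (min_le_left _ _).trans_lt (by linarith)
  have hη2 : η ≤ d / 2 := (min_le_right _ _).trans (min_le_left _ _)
  have hη3 : η ≤ m / 2 := (min_le_right _ _).trans (min_le_right _ _)
  have hmem : m - η ∈ G := by
    refine ⟨by linarith, by linarith, fun ν h1 h2 => ?_⟩
    rcases lt_or_ge m ν with h3 | h3
    · exact habove ν h3 h2
    · refine hnar ν (by linarith) h2 fun x hx hxd hne => ?_
      refine hev ν ?_ x hx (by linarith) hne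
      rw [mem_ball, Real.dist_eq, abs_lt]
      constructor <;> linarith
  have := csInf_le hGb hmem
  linarith

/-! ### Radial symmetry and strict monotonicity -/

omit he in
-- With e along x - y, the reflection in the plane through the origin carries x to y; exchanging the
-- roles gives the other inequality.
theorem eq_of_norm_eq (H : IsSolution ε F u) {x y : E n} (hx : ‖x‖ < 1) (hx0 : x ≠ 0)
    (hxy : ‖x‖ = ‖y‖) : u x = u y := by
  have key : ∀ x y : E n, ‖x‖ < 1 → x ≠ 0 → ‖x‖ = ‖y‖ → x ≠ y → u x ≤ u y := by
    intro x y hx hx0 hxy hne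
    have hr : 0 < ‖x - y‖ := norm_pos_iff.2 (sub_ne_zero.2 hne)
    set e : E n := ‖x - y‖⁻¹ • (x - y) with he
    have he1 : ‖e‖ = 1 := by
      rw [he, norm_smul, norm_inv, norm_norm, inv_mul_cancel₀ hr.ne']
    have h1 : inner ℝ x (x - y) = ‖x - y‖ ^ 2 / 2 := by
      rw [norm_sub_sq_real, inner_sub_right, real_inner_self_eq_norm_sq, hxy]
      ring
    have h2 : inner ℝ x e = ‖x - y‖ / 2 := by
      rw [he, inner_smul_right, h1]
      field_simp
    have h3 : refl e 0 x = y := by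
      rw [refl, h2, sub_zero, he, smul_smul]
      rw [show 2 * (‖x - y‖ / 2) * ‖x - y‖⁻¹ = 1 by field_simp, one_smul]
      abel
    have := H.reflLE he1 le_rfl one_pos x hx (by rw [h2]; positivity) (by simpa using hx0)
    rwa [h3] at this
  by_cases hne : x = y
  · rw [hne]
  · have hy0 : y ≠ 0 := norm_pos_iff.1 (hxy ▸ norm_pos_iff.2 hx0)
    exact le_antisymm (key x y hx hx0 hxy hne) (key y x (hxy ▸ hx) hy0 hxy.symm (Ne.symm hne))

theorem differentiableAt_and_deriv_neg (H : IsSolution ε F u) {r : ℝ} (hr : r ∈ Ioo (0 : ℝ) 1) :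
    DifferentiableAt ℝ (fun t : ℝ => u (t • e)) r ∧ deriv (fun t : ℝ => u (t • e)) r < 0 := by
  have hn : ‖r • e‖ = r := by rw [norm_smul, he, mul_one, Real.norm_of_nonneg hr.1.le]
  have he0 : e ≠ 0 := fun h => by simp [h] at he
  have hi : inner ℝ (r • e) e = r := by
    rw [inner_smul_left, inner_self_of_unit he]
    simp
  have h0 : r • e ≠ 0 := smul_ne_zero hr.1.ne' he0
  have hlt : ‖r • e‖ < 1 := by rw [hn]; exact hr.2
  have hu := H.contDiffAt hlt h0
  have hd : DifferentiableAt ℝ (fun t : ℝ => u (t • e)) r :=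
    DifferentiableAt.comp (f := fun t : ℝ => t • e) r (hu.differentiableAt (by norm_num))
      (by fun_prop)
  refine ⟨hd, ?_⟩
  have hne : r • e ≠ (2 * r) • e := fun h => by
    have := smul_left_injective ℝ he0 h
    linarith [hr.1]
  have hrefl : refl e r (r • e) = r • e := refl_of_inner_eq hi
  have hP := H.reflLE he hr.1.le hr.2
  obtain ⟨c, hc, hev⟩ := hopf (u := u) (v := fun y => u (refl e r y)) H.contDiffOn_op H.elliptic
    one_pos he ⟨by rw [hn]; exact hr.1, by linarith [H.eps_pos]⟩ hu
    (contDiffAt_comp_refl (by rwa [hrefl])) (by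
      filter_upwards [continuous_norm.continuousAt.eventually (gt_mem_nhds hlt),
        isOpen_ne.mem_nhds hne] with x h1 h2 h3
      have hrx : r < inner ℝ x e := by
        rw [mem_ball_iff_norm] at h3
        have h4 := (abs_le.1 (abs_inner_le_of_unit he (x - (r • e + (1 : ℝ) • e)))).1
        rw [inner_sub_left, inner_add_left, hi, one_smul, inner_self_of_unit he] at h4
        rw [one_smul] at h3
        linarith
      exact ⟨(H.jet_le_jet_refl he hr.1 h1 hrx.le h2).2.2,
        H.lt_refl he hr.1 hr.2 hP h1 hrx h2⟩) (by simp only [hrefl])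
  -- Along the normal to the plane through re, this is the reflected function minus u; the Hopf
  -- lemma bounds its slope below by c > 0.
  have hg : HasDerivAt (fun t : ℝ => u ((r - t) • e) - u ((r + t) • e))
      (-2 * deriv (fun t : ℝ => u (t • e)) r) 0 := by
    have h1 : HasDerivAt (fun t : ℝ => r - t) (-1) 0 := by
      simpa using (hasDerivAt_id (0 : ℝ)).const_sub r
    have h2 : HasDerivAt (fun t : ℝ => r + t) 1 0 := by
      simpa using (hasDerivAt_id (0 : ℝ)).const_add r
    have h3 := hd.hasDerivAt
    have h4 : HasDerivAt (fun t : ℝ => u ((r - t) • e))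
        (deriv (fun t : ℝ => u (t • e)) r * -1) 0 :=
      HasDerivAt.comp (h₂ := fun t : ℝ => u (t • e)) (0 : ℝ) (by simpa using h3) h1
    have h5 : HasDerivAt (fun t : ℝ => u ((r + t) • e))
        (deriv (fun t : ℝ => u (t • e)) r * 1) 0 :=
      HasDerivAt.comp (h₂ := fun t : ℝ => u (t • e)) (0 : ℝ) (by simpa using h3) h2
    exact (h4.sub h5).congr_deriv (by ring)
  have := le_of_eventually_mul_le hg (by simp) (by
    filter_upwards [hev] with t ht
    have h1 : r • e + t • e = (r + t) • e := (add_smul _ _ _).symm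
    have h2 : refl e r ((r + t) • e) = (r - t) • e := by
      rw [refl, inner_smul_left, inner_self_of_unit he, ← sub_smul]
      simp only [RCLike.conj_to_real]
      congr 1
      ring
    rwa [h1, h2] at ht)
  linarith

end IsSolution

end PuncturedBall

theorem corollary1p2 (n : ℕ) (hn : 1 ≤ n) (ε : ℝ) (hε : 0 < ε)
    (F : ℝ → ℝ → PuncturedBall.E n → PuncturedBall.SymMat n → ℝ)
    -- `F` is of class `C¹` on `(0, 1 + ε) × ℝ × ℝⁿ × 𝒮^{n×n}`
    (hF : ContDiffOn ℝ 1
      (fun q : ℝ × ℝ × PuncturedBall.E n × PuncturedBall.SymMat n =>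
        F q.1 q.2.1 q.2.2.1 q.2.2.2)
      (Set.Ioo 0 (1 + ε) ×ˢ Set.univ))
    -- ellipticity
    (hell : ∀ r s : ℝ, 0 < r → r < 1 + ε → ∀ (p : PuncturedBall.E n)
      (M : PuncturedBall.SymMat n), (-PuncturedBall.gradM F r s p M).PosDef)
    -- `∂F/∂r ≥ 0`
    (hmono : ∀ r s : ℝ, 0 < r → r < 1 + ε → 0 < s → ∀ (p : PuncturedBall.E n)
      (M : PuncturedBall.SymMat n), 0 ≤ deriv (fun ρ => F ρ s p M) r)
    -- invariance under orthogonal transformations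
    (hinv : ∀ r s : ℝ, 0 < r → r < 1 + ε → 0 < s → ∀ (p : PuncturedBall.E n)
      (M : PuncturedBall.SymMat n) (O : Matrix (Fin n) (Fin n) ℝ),
      O ∈ Matrix.orthogonalGroup (Fin n) ℝ →
      F r s (PuncturedBall.act O.transpose p) (PuncturedBall.conj O M) = F r s p M)
    (u : PuncturedBall.E n → ℝ)
    (hu : ContDiffOn ℝ 2 u (Metric.closedBall 0 1 \ {0}))
    (hsuper : ∃ rbar : ℝ, 0 < rbar ∧ PuncturedBall.SuperaffineNearZero u rbar)
    (heq : ∀ x ∈ Metric.ball (0 : PuncturedBall.E n) 1 \ {0},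
      F ‖x‖ (u x) (gradient u x) (PuncturedBall.hessian u x) = 0)
    (hpos : ∀ x ∈ Metric.ball (0 : PuncturedBall.E n) 1 \ {0}, 0 < u x)
    (hbdry : ∀ x ∈ Metric.sphere (0 : PuncturedBall.E n) 1, u x = 0) :
    ∃ φ : ℝ → ℝ,
      (∀ x ∈ Metric.closedBall (0 : PuncturedBall.E n) 1 \ {0}, u x = φ ‖x‖) ∧
      ∀ r ∈ Set.Ioo (0 : ℝ) 1, DifferentiableAt ℝ φ r ∧ deriv φ r < 0 := by
  have H : PuncturedBall.IsSolution ε F u :=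
    ⟨hε, hF, hell, hmono, hinv, hu, hsuper, heq, hpos, hbdry⟩
  -- Any unit vector would do; n ≥ 1 provides one along which to read off the profile.
  set e : PuncturedBall.E n := EuclideanSpace.single ⟨0, hn⟩ 1 with he
  have he1 : ‖e‖ = 1 := by simp [he]
  refine ⟨fun r => u (r • e), fun x hx => ?_, fun r hr => H.differentiableAt_and_deriv_neg he1 hr⟩
  have hnorm : ‖‖x‖ • e‖ = ‖x‖ := by rw [norm_smul, he1, mul_one, norm_norm]
  rcases (mem_closedBall_zero_iff.1 hx.1).lt_or_eq with h | h
  · exact H.eq_of_norm_eq h hx.2 hnorm.symm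
  · exact (hbdry x (mem_sphere_zero_iff_norm.2 h)).trans
      (hbdry _ (mem_sphere_zero_iff_norm.2 (hnorm.trans h))).symm
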